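/- Let $\Phi_B$ (macro base stations) and $\Phi_F$ (femto access points) be independent homogeneous Poisson point processes in $\mathbb{R}^2$ with densities $\lambda_B,\lambda_F>0$, let $P_B,P_F>0$ be the transmission powers, $\tilde P_F=P_F/P_B$, let $\alpha>2$ be the path-loss exponent and $\delta=2/\alpha$. A user is at the origin and is served by the station $x_0\in\Phi_B$ with the largest mean received power $P_B\|x\|^{-\alpha}$. The fading coefficients $h_x$, $x\in\Phi_B\cup\Phi_F$, are i.i.d. exponential with mean $1$. Each macro station is, independently, active on the user's channel with probability $\zeta_{SC}\in[0,1]$ (its activity factor); each femto access point independently uses one of the $p_mN\ge 1$ channels available to it ($N$ the total number of channels, $0<p_m\le1$), hence is on the user's channel with probability $1/(p_mN)$. Positions, fading coefficients and activities are mutually independent. Put $$\mathrm{SIR}=\frac{h_{x_0}\|x_0\|^{-\alpha}}{I_c+I_f},\qquad I_c=\sum_{x\in\Phi_B\setminus\{x_0\}\ \text{active}}h_x\|x\|^{-\alpha},\qquad I_f=\sum_{x\in\Phi_F\ \text{active}}h_x\|x\|^{-\alpha}\tilde P_F .$$ Let $R_m$ and $R_d$ be the distances from the origin to the closest and to the second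 closest point of $\Phi_B$, and let $0<R\le1$. The user is a cell-center user if $R_m/R_d\le R$. Then for every threshold $\beta>0$ the coverage probability of a cell-center user under shared spectrum allocation, $\mathcal C_{SC}(\beta)=\mathbb{P}\bigl(\mathrm{SIR}>\beta \,\big|\, R_m/R_d\le R\bigr)$, is $$\mathcal C_{SC}(\beta)=\left[1+\zeta_{SC}R^2\mathcal H(\beta,\delta,R)+\pi\delta R^2\frac{\tilde\lambda_F}{\lambda_B}(\beta\tilde P_F)^{\delta}\csc(\pi\delta)\right]^{-1},$$ where $\tilde\lambda_F=\frac{\lambda_F}{p_mN}$ and $\mathcal H(\beta,\delta,R)=\beta^{\delta}\int_{R^{-2}\beta^{-\delta}}^{\infty}\frac{du}{1+u^{1/\delta}}$ is a convergent integral. Moreover, for $\delta=\tfrac12$, $\mathcal H(\beta,\tfrac12,R)=\beta^{1/2}\arctan(R^2\beta^{1/2})$. -/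

import Mathlib

open MeasureTheory ProbabilityTheory Set
open scoped ENNReal

noncomputable section

namespace HetNet

/-- The plane `ℝ²` with its Euclidean norm. -/
abbrev Plane : Type := EuclideanSpace ℝ (Fin 2)

/-! ### Poisson point processes, given by an enumeration of their points -/

/-- The number of points of the (enumerated) point process `X` that lie in `B`. -/
def pointCount {Ω : Type*} (X : ℕ → Ω → Plane) (B : Set Plane) (ω : Ω) : ℕ∞ :=
  {i : ℕ | X i ω ∈ B}.encard

/-- `X` enumerates the points of a homogeneous Poisson point process of density `lam` in `ℝ²`:
the number of points in a Borel set of finite area is Poisson with mean `lam` times the area, and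
the numbers of points in finitely many pairwise disjoint Borel sets are independent.
(For `lam > 0` such a process has almost surely infinitely many points, so that indexing them by
`ℕ` is no restriction.) -/
structure IsPoissonProcess {Ω : Type*} [MeasurableSpace Ω] (μ : Measure Ω) (lam : ℝ)
    (X : ℕ → Ω → Plane) : Prop where
  measurable : ∀ i, Measurable (X i)
  count_law : ∀ B : Set Plane, MeasurableSet B → volume B ≠ ∞ → ∀ k : ℕ,
    μ {ω | pointCount X B ω = (k : ℕ∞)} =
      poissonMeasure (Real.toNNReal (lam * volume.real B)) {k}
  count_indep : ∀ (n : ℕ) (B : Fin n → Set Plane), (∀ k, MeasurableSet (B k)) →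
    (Pairwise fun k l => Disjoint (B k) (B l)) →
    iIndepFun (fun k => pointCount X (B k)) μ

/-! ### The two-tier network -/

/-- The random data of a two-tier network: positions of the macro base stations and of the femto
access points, the fading coefficient of the link from each of them to the user, and for each of
them the indicator of its being active on the user's channel. -/
structure Network (Ω : Type*) where
  macroPos : ℕ → Ω → Plane
  femtoPos : ℕ → Ω → Plane
  macroFading : ℕ → Ω → ℝ
  femtoFading : ℕ → Ω → ℝ
  macroActive : ℕ → Ω → Bool
  femtoActive : ℕ → Ω → Bool

/-- The labels of the independent sources of randomness of the network. -/
inductive Source : Type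
  | macroPositions
  | femtoPositions
  | macroFading (i : ℕ)
  | femtoFading (i : ℕ)
  | macroActivity (i : ℕ)
  | femtoActivity (i : ℕ)

variable {Ω : Type*}

/-- The σ-algebra generated by one of the sources of randomness. Each of the two point processes,
taken as a whole, is one source; every single mark is a source of its own. -/
@[reducible] def Network.sigmaAlgebra (S : Network Ω) : Source → MeasurableSpace Ω
  | .macroPositions => MeasurableSpace.comap (fun ω i => S.macroPos i ω) inferInstance
  | .femtoPositions => MeasurableSpace.comap (fun ω i => S.femtoPos i ω) inferInstance
  | .macroFading i => MeasurableSpace.comap (S.macroFading i) inferInstance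
  | .femtoFading i => MeasurableSpace.comap (S.femtoFading i) inferInstance
  | .macroActivity i => MeasurableSpace.comap (S.macroActive i) inferInstance
  | .femtoActivity i => MeasurableSpace.comap (S.femtoActive i) inferInstance

/-- The stochastic model: independent homogeneous Poisson processes of densities `lamB` (macro
tier) and `lamF` (femto tier), independent unit-mean exponential (Rayleigh) fading, and
independent thinning: a macro station is co-channel with probability `zeta`, and a femto access
point is co-channel with probability `q`. -/
structure Network.IsModel [MeasurableSpace Ω] (S : Network Ω) (μ : Measure Ω)
    (lamB lamF zeta q : ℝ) : Prop where
  macro_poisson : IsPoissonProcess μ lamB S.macroPos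
  femto_poisson : IsPoissonProcess μ lamF S.femtoPos
  macro_fading : ∀ i, HasLaw (S.macroFading i) (expMeasure 1) μ
  femto_fading : ∀ i, HasLaw (S.femtoFading i) (expMeasure 1) μ
  macro_fading_measurable : ∀ i, Measurable (S.macroFading i)
  femto_fading_measurable : ∀ i, Measurable (S.femtoFading i)
  macro_active_measurable : ∀ i, Measurable (S.macroActive i)
  femto_active_measurable : ∀ i, Measurable (S.femtoActive i)
  macro_active : ∀ i, μ {ω | S.macroActive i ω = true} = ENNReal.ofReal zeta
  femto_active : ∀ i, μ {ω | S.femtoActive i ω = true} = ENNReal.ofReal q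
  indep : iIndep S.sigmaAlgebra μ

/-- The distance from the origin to the `k`-th closest point of `X` (`k = 1, 2, …`): the least
radius of a closed ball around the origin that contains at least `k` points. -/
def kthDist (X : ℕ → Ω → Plane) (k : ℕ) (ω : Ω) : ℝ :=
  sInf {r : ℝ | (k : ℕ∞) ≤ pointCount X (Metric.closedBall 0 r) ω}

/-- The power-law path loss `‖x‖ ^ (-α)` between `x` and the origin. -/
def pathLoss (α : ℝ) (x : Plane) : ℝ≥0∞ := ‖x‖ₑ ^ (-α)

/-- The (index of the) serving macro station of the user at the origin: the station with the
largest mean received power `P_B ‖x‖ ^ (-α)`. -/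
def Network.serving (S : Network Ω) (α PB : ℝ) (ω : Ω) : ℕ :=
  sInf {i : ℕ | ∀ j, ENNReal.ofReal PB * pathLoss α (S.macroPos j ω) ≤
    ENNReal.ofReal PB * pathLoss α (S.macroPos i ω)}

/-- The interference from the co-channel macro stations other than the serving one, in units of
the macro transmission power. -/
def Network.macroInterference (S : Network Ω) (α PB : ℝ) (ω : Ω) : ℝ≥0∞ :=
  ∑' i : ℕ, if i ≠ S.serving α PB ω ∧ S.macroActive i ω = true then
    ENNReal.ofReal (S.macroFading i ω) * pathLoss α (S.macroPos i ω) else 0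

/-- The interference from the co-channel femto access points, in units of the macro transmission
power. -/
def Network.femtoInterference (S : Network Ω) (α PB PF : ℝ) (ω : Ω) : ℝ≥0∞ :=
  ∑' i : ℕ, if S.femtoActive i ω = true then
    ENNReal.ofReal (S.femtoFading i ω) * pathLoss α (S.femtoPos i ω) * ENNReal.ofReal (PF / PB)
    else 0

/-- The signal-to-interference ratio of a cell-center user under shared spectrum allocation. -/
def Network.sir (S : Network Ω) (α PB PF : ℝ) (ω : Ω) : ℝ≥0∞ :=
  ENNReal.ofReal (S.macroFading (S.serving α PB ω) ω) *
      pathLoss α (S.macroPos (S.serving α PB ω) ω) /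
    (S.macroInterference α PB ω + S.femtoInterference α PB PF ω)

/-- The event that the user at the origin is a cell-center user. -/
def Network.cellCenter (S : Network Ω) (R : ℝ) : Set Ω :=
  {ω | kthDist S.macroPos 1 ω / kthDist S.macroPos 2 ω ≤ R}

/-- The event that the SIR of the user at the origin exceeds the threshold `β`. -/
def Network.covered (S : Network Ω) (α PB PF β : ℝ) : Set Ω :=
  {ω | ENNReal.ofReal β < S.sir α PB PF ω}

/-- The coverage probability of a cell-center user under shared spectrum allocation: the
conditional probability of coverage given that the user is a cell-center user. -/
def Network.coverageProb [MeasurableSpace Ω] (S : Network Ω) (μ : Measure Ω)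
    (α PB PF R β : ℝ) : ℝ :=
  (ProbabilityTheory.cond μ (S.cellCenter R)).real (S.covered α PB PF β)

/-- `H(β, δ, R) = β ^ δ ∫_{R⁻² β^(-δ)}^∞ du / (1 + u ^ (1/δ))`. -/
def H (β δ R : ℝ) : ℝ :=
  β ^ δ * ∫ u in Ioi (R ^ (-2 : ℝ) * β ^ (-δ)), 1 / (1 + u ^ (1 / δ))

end HetNet

end

/-!
The probability of coverage is computed by summing over the macro station that serves the user.
For `R ≤ 1`, almost surely at most one station `i` satisfies `‖x i‖ ≤ R * ‖x j‖` for all `j ≠ i`;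
if there is one, it is the serving station, and its existence is the cell-center event
(`ae_exists_serving`). Both the probability of the cell-center event and that of its intersection
with coverage are therefore sums over `i` of probabilities that single out the station `i`.

For frozen positions, Rayleigh fading makes the conditional probability of coverage by station `i`
the expectation of `exp (-V)`, where `V` is the interference relative to the mean received power
of that station. By independence of the marks this is a product over all other stations, that is
`exp (-∑ f)` for an explicit function `f` of their positions (`measure_interference_lt_fading`).
The requirement that all other stations be farther away by the factor `1 / R` is absorbed into `f`
by giving it the value `∞` where the requirement fails.

Two formulas for a Poisson process of density `λ` then finish the computation: the Laplace
functional `E exp (-∑ f) = exp (-λ ∫ (1 - exp (-f)))` for the femto tier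
(`lintegral_expNeg_tsum`), and for the macro tier the Palm formula
`E ∑ᵢ u(xᵢ) exp (-∑_{j ≠ i} f(xᵢ, xⱼ)) = λ ∫ u(x) exp (-λ ∫ (1 - exp (-f(x, y))) dy) dx`
(`tsum_lintegral_mul_expNeg_norm`). Both are proved from complete independence for simple
functions and extended by monotone approximation. The dependence of `f` on `x` is through `‖x‖`,
monotone and left-continuous, so that it can be discretized dyadically.

With `r = ‖x‖`, all exponents turn out to be multiples of `r ^ 2`, and the integral over `x` is
Gaussian. The femto exponent involves `∫₀^∞ dv / (1 + v ^ p)`, which Tonelli's theorem reduces to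
`Γ (1 + 1 / p) Γ (1 - 1 / p)`. For `R = 1` and without interference the Palm formula says that the
expected number of closest stations is `1`, which is how ties are excluded
(`ae_exists_forall_norm_lt`).
-/

noncomputable section

namespace HetNet

open Filter Topology

/-! ### The exponential function on `[0, ∞]` -/

section

/-- The function `x ↦ exp (-x)` on `[0, ∞]`, with `exp (-∞) = 0`. -/
def expNeg (x : ℝ≥0∞) : ℝ≥0∞ := EReal.exp (-(x : EReal))

@[simp] lemma expNeg_zero : expNeg 0 = 1 := by simp [expNeg]

@[simp] lemma expNeg_top : expNeg ∞ = 0 := by simp [expNeg]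

lemma expNeg_add (x y : ℝ≥0∞) : expNeg (x + y) = expNeg x * expNeg y := by
  rw [expNeg, EReal.coe_ennreal_add, EReal.neg_add (by simp) (by simp), sub_eq_add_neg,
    EReal.exp_add]
  rfl

lemma expNeg_antitone : Antitone expNeg := fun x y h =>
  EReal.exp_monotone (EReal.neg_le_neg_iff.2 (by exact_mod_cast h))

lemma expNeg_le_one (x : ℝ≥0∞) : expNeg x ≤ 1 := by
  simpa using expNeg_antitone (zero_le (a := x))

lemma expNeg_ne_top (x : ℝ≥0∞) : expNeg x ≠ ∞ :=
  ((expNeg_le_one x).trans_lt ENNReal.one_lt_top).ne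

lemma continuous_expNeg : Continuous expNeg :=
  ENNReal.continuous_exp.comp (continuous_neg.comp continuous_coe_ennreal_ereal)

@[fun_prop]
lemma measurable_expNeg : Measurable expNeg := continuous_expNeg.measurable

lemma expNeg_ofReal {x : ℝ} (hx : 0 ≤ x) :
    expNeg (ENNReal.ofReal x) = ENNReal.ofReal (Real.exp (-x)) := by
  rw [expNeg, EReal.coe_ennreal_ofReal, max_eq_left hx, ← EReal.coe_neg, EReal.exp_coe]

lemma expNeg_sum {ι : Type*} (s : Finset ι) (f : ι → ℝ≥0∞) :
    expNeg (∑ i ∈ s, f i) = ∏ i ∈ s, expNeg (f i) := by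
  induction s using Finset.cons_induction with
  | empty => simp
  | cons j s hj ih => rw [Finset.sum_cons, Finset.prod_cons, expNeg_add, ih]

lemma expNeg_mul_natCast (c : ℝ≥0∞) (n : ℕ) : expNeg (c * n) = expNeg c ^ n := by
  induction n with
  | zero => simp
  | succ n ih => rw [Nat.cast_succ, mul_add, mul_one, expNeg_add, ih, pow_succ]

/-- The function `p ↦ -log p` on `[0, 1]`, with `-log 0 = ∞`. -/
def negLog (p : ℝ≥0∞) : ℝ≥0∞ := (-(ENNReal.log p)).toENNReal

lemma expNeg_negLog {p : ℝ≥0∞} (hp : p ≤ 1) : expNeg (negLog p) = p := by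
  rw [expNeg, negLog, EReal.coe_toENNReal, neg_neg, ENNReal.exp_log]
  rw [EReal.le_neg, neg_zero]
  exact ENNReal.log_le_zero_iff.2 hp

lemma negLog_antitone : Antitone negLog := fun _ _ h =>
  EReal.toENNReal_le_toENNReal (EReal.neg_le_neg_iff.2 (ENNReal.log_monotone h))

lemma continuous_negLog : Continuous negLog :=
  EReal.continuous_toENNReal.comp (continuous_neg.comp ENNReal.continuous_log)

/-! ### Generating functions of the Poisson distribution -/

lemma tsum_poissonMeasure_mul_pow (a : NNReal) {z : ℝ≥0∞} (hz : z ≤ 1) :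
    ∑' k : ℕ, z ^ k * poissonMeasure a {k} = expNeg (a * (1 - z)) := by
  have hz' : z ≠ ∞ := (hz.trans_lt ENNReal.one_lt_top).ne
  lift z to NNReal using hz'
  have hz1 : (z : ℝ) ≤ 1 := by exact_mod_cast hz
  have hs : HasSum (fun k : ℕ => (z : ℝ) ^ k * (Real.exp (-a) * a ^ k / k.factorial))
      (Real.exp (-(a * (1 - z)))) := by
    convert! (NormedSpace.expSeries_div_hasSum_exp ((a * z : ℝ))).mul_left (Real.exp (-a)) using 1
    · ext k; rw [mul_pow]; ring
    · rw [← Real.exp_eq_exp_ℝ, ← Real.exp_add]; congr 1; ring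
  have h1 : ∀ k : ℕ, (z : ℝ≥0∞) ^ k * poissonMeasure a {k} =
      ENNReal.ofReal ((z : ℝ) ^ k * (Real.exp (-a) * a ^ k / k.factorial)) := by
    intro k
    rw [poissonMeasure_singleton, ENNReal.ofReal_mul (by positivity),
      ENNReal.ofReal_pow (by positivity), ENNReal.ofReal_coe_nnreal]
  simp_rw [h1]
  rw [← ENNReal.ofReal_tsum_of_nonneg (fun k => by positivity) hs.summable, hs.tsum_eq,
    ← expNeg_ofReal (mul_nonneg a.coe_nonneg (by linarith)), ENNReal.ofReal_mul a.coe_nonneg,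
    ENNReal.ofReal_sub _ z.coe_nonneg]
  simp

lemma tsum_poissonMeasure_mul_natCast_mul_pow (a : NNReal) {z : ℝ≥0∞} (hz : z ≤ 1) :
    ∑' k : ℕ, (k * z ^ (k - 1)) * poissonMeasure a {k} = a * expNeg (a * (1 - z)) := by
  rw [← tsum_poissonMeasure_mul_pow a hz, ← ENNReal.tsum_mul_left,
    tsum_eq_zero_add' ENNReal.summable]
  rw [show ((0 : ℕ) : ℝ≥0∞) = 0 by simp, zero_mul, zero_mul, zero_add]
  refine tsum_congr fun k => ?_
  have : ((k + 1 : ℕ) : ℝ≥0∞) * poissonMeasure a {k + 1} = a * poissonMeasure a {k} := by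
    rw [poissonMeasure_singleton, poissonMeasure_singleton, ← ENNReal.ofReal_natCast,
      ← ENNReal.ofReal_coe_nnreal (p := a), ← ENNReal.ofReal_mul (by positivity),
      ← ENNReal.ofReal_mul a.coe_nonneg]
    congr 1
    rw [Nat.factorial_succ]; push_cast; field_simp; ring
  rw [Nat.add_sub_cancel, mul_right_comm, this]; ring

end

/-! ### Laplace functional of a Poisson process -/

section

variable {Ω : Type*}

lemma tsum_indicator_eq_pointCount (X : ℕ → Ω → Plane) (B : Set Plane) (ω : Ω) :
    ∑' i, B.indicator (1 : Plane → ℝ≥0∞) (X i ω) = (pointCount X B ω : ℝ≥0∞) := by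
  rw [pointCount, ← ENNReal.tsum_set_one, tsum_subtype {i | X i ω ∈ B} (fun _ => (1 : ℝ≥0∞))]
  rfl

variable [MeasurableSpace Ω] {μ : Measure Ω} {lam : ℝ} {X : ℕ → Ω → Plane}

lemma measurable_toENNReal_pointCount (hX : ∀ i, Measurable (X i)) {B : Set Plane}
    (hB : MeasurableSet B) : Measurable fun ω => (pointCount X B ω : ℝ≥0∞) := by
  simp_rw [← tsum_indicator_eq_pointCount]
  exact Measurable.tsum fun i => (measurable_one.indicator hB).comp (hX i)

lemma measurable_pointCount (hX : ∀ i, Measurable (X i)) {B : Set Plane}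
    (hB : MeasurableSet B) : Measurable (pointCount X B) := by
  refine ENat.measurable_iff.2 fun n => ?_
  convert! measurable_toENNReal_pointCount hX hB (measurableSet_singleton (n : ℝ≥0∞)) using 1
  ext ω
  simp only [mem_preimage, mem_singleton_iff]
  rw [← ENat.toENNReal_coe, ENat.toENNReal_inj]

namespace IsPoissonProcess

lemma coe_toNNReal_mul (hlam : 0 ≤ lam) {B : Set Plane} (hB' : volume B ≠ ∞) :
    (Real.toNNReal (lam * volume.real B) : ℝ≥0∞) = ENNReal.ofReal lam * volume B := by
  rw [← ENNReal.ofReal, ENNReal.ofReal_mul hlam, ofReal_measureReal hB']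

variable [IsProbabilityMeasure μ]

lemma map_pointCount (hX : IsPoissonProcess μ lam X) {B : Set Plane}
    (hB : MeasurableSet B) (hB' : volume B ≠ ∞) :
    μ.map (pointCount X B) =
      (poissonMeasure (Real.toNNReal (lam * volume.real B))).map (Nat.cast : ℕ → ℕ∞) := by
  set P := poissonMeasure (Real.toNNReal (lam * volume.real B))
  have hm := measurable_pointCount hX.measurable hB
  have : IsProbabilityMeasure (μ.map (pointCount X B)) :=
    Measure.isProbabilityMeasure_map hm.aemeasurable
  have h1 : ∀ k : ℕ, μ.map (pointCount X B) {(k : ℕ∞)} = P.map (Nat.cast : ℕ → ℕ∞) {(k : ℕ∞)} := by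
    intro k
    rw [Measure.map_apply hm (measurableSet_singleton _),
      Measure.map_apply .of_discrete (measurableSet_singleton _)]
    convert! hX.count_law B hB hB' k using 2
    ext n; simp
  have h2 : ({⊤}ᶜ : Set ℕ∞) = ⋃ k : ℕ, {(k : ℕ∞)} := by
    ext n
    cases n <;> simp
  have h3 : μ.map (pointCount X B) {⊤}ᶜ = P.map (Nat.cast : ℕ → ℕ∞) {⊤}ᶜ := by
    have hd : Pairwise (Function.onFun Disjoint fun k : ℕ => ({(k : ℕ∞)} : Set ℕ∞)) := by
      intro i j hij
      simp [Function.onFun, hij]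
    rw [h2, measure_iUnion hd fun _ => measurableSet_singleton _,
      measure_iUnion hd fun _ => measurableSet_singleton _]
    simp_rw [h1]
  refine Measure.ext_of_singleton fun n => ?_
  cases n with
  | coe k => exact h1 k
  | top =>
    have e1 := prob_compl_eq_one_sub (μ := μ.map (pointCount X B)) (measurableSet_singleton ⊤).compl
    have e2 := prob_compl_eq_one_sub (μ := P.map (Nat.cast : ℕ → ℕ∞))
      (measurableSet_singleton ⊤).compl
    rw [compl_compl] at e1 e2
    rw [e1, e2, h3]

lemma lintegral_comp_pointCount (hX : IsPoissonProcess μ lam X) {B : Set Plane}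
    (hB : MeasurableSet B) (hB' : volume B ≠ ∞) (g : ℕ∞ → ℝ≥0∞) :
    ∫⁻ ω, g (pointCount X B ω) ∂μ =
      ∑' k : ℕ, g k * poissonMeasure (Real.toNNReal (lam * volume.real B)) {k} := by
  rw [← lintegral_map (measurable_of_countable g) (measurable_pointCount hX.measurable hB),
    hX.map_pointCount hB hB', lintegral_map (measurable_of_countable g) .of_discrete,
    lintegral_countable']

lemma lintegral_expNeg_mul_pointCount (hX : IsPoissonProcess μ lam X) (hlam : 0 ≤ lam)
    {B : Set Plane} (hB : MeasurableSet B) (hB' : volume B ≠ ∞) (c : ℝ≥0∞) :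
    ∫⁻ ω, expNeg (c * (pointCount X B ω : ℝ≥0∞)) ∂μ =
      expNeg (ENNReal.ofReal lam * volume B * (1 - expNeg c)) := by
  rw [hX.lintegral_comp_pointCount hB hB' fun n => expNeg (c * n), ← coe_toNNReal_mul hlam hB',
    ← tsum_poissonMeasure_mul_pow _ (expNeg_le_one c)]
  simp [expNeg_mul_natCast]

lemma lintegral_pointCount (hX : IsPoissonProcess μ lam X) (hlam : 0 ≤ lam)
    {B : Set Plane} (hB : MeasurableSet B) (hB' : volume B ≠ ∞) :
    ∫⁻ ω, (pointCount X B ω : ℝ≥0∞) ∂μ = ENNReal.ofReal lam * volume B := by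
  rw [hX.lintegral_comp_pointCount hB hB' fun n => n, ← coe_toNNReal_mul hlam hB']
  simpa using tsum_poissonMeasure_mul_natCast_mul_pow (Real.toNNReal (lam * volume.real B)) le_rfl

lemma ae_pointCount_ne_top (hX : IsPoissonProcess μ lam X) (hlam : 0 ≤ lam)
    {B : Set Plane} (hB : MeasurableSet B) (hB' : volume B ≠ ∞) :
    ∀ᵐ ω ∂μ, pointCount X B ω ≠ ⊤ := by
  have h := ae_lt_top (measurable_toENNReal_pointCount hX.measurable hB) (μ := μ) (by
    rw [hX.lintegral_pointCount hlam hB hB']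
    exact ENNReal.mul_ne_top ENNReal.ofReal_ne_top hB')
  filter_upwards [h] with ω hω h'
  simp [h'] at hω

/-- Complete independence of the process, tested on a bounded set `C` and on a simple function
of the points outside `C`. -/
lemma lintegral_pointCount_mul_expNeg_simpleFunc (hX : IsPoissonProcess μ lam X) (hlam : 0 ≤ lam)
    (f : SimpleFunc Plane ℝ≥0∞) (hf : ∀ v ≠ 0, volume (f ⁻¹' {v}) ≠ ∞) {C : Set Plane}
    (hC : MeasurableSet C) (g : ℕ∞ → ℝ≥0∞) :
    ∫⁻ ω, g (pointCount X C ω) * expNeg (∑' j, Cᶜ.indicator f (X j ω)) ∂μ =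
      (∫⁻ ω, g (pointCount X C ω) ∂μ) *
        expNeg (ENNReal.ofReal lam * ∫⁻ x in Cᶜ, (1 - expNeg (f x))) := by
  classical
  let D : ℝ≥0∞ → Set Plane := fun v => f ⁻¹' {v} ∩ Cᶜ
  have hD : ∀ v, MeasurableSet (D v) := fun v => (f.measurableSet_fiber v).inter hC.compl
  let B : Option f.range → Set Plane := fun o => o.elim C fun v => D v
  have hB : ∀ o, MeasurableSet (B o) := by
    rintro (_ | v)
    · exact hC
    · exact hD v
  have hBd : Pairwise fun k l => Disjoint (B k) (B l) := by
    rintro (_ | v) (_ | w) hvw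
    · exact absurd rfl hvw
    · exact disjoint_compl_right.mono_right inter_subset_right
    · exact (disjoint_compl_right.mono_right inter_subset_right).symm
    · refine Disjoint.mono inter_subset_left inter_subset_left ?_
      refine Disjoint.preimage _ (disjoint_singleton.2 fun h => hvw ?_)
      rw [Subtype.ext h]
  let e := Fintype.equivFin (Option f.range)
  have hind : iIndepFun (fun o => pointCount X (B o)) μ := by
    have := (hX.count_indep _ (fun k => B (e.symm k)) (fun k => hB _)
      fun k l hkl => hBd (e.symm.injective.ne hkl)).precomp e.injective
    simpa using this
  let G : Option f.range → ℕ∞ → ℝ≥0∞ := fun o => o.elim g fun v n => expNeg (v * n)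
  have hind' := hind.comp G fun o => measurable_of_countable _
  have hprod := lintegral_prod_eq_prod_lintegral_of_indepFun Finset.univ _ hind' fun o =>
    (measurable_of_countable (G o)).comp (measurable_pointCount hX.measurable (hB o))
  simp only [Fintype.prod_option, Function.comp_apply] at hprod
  have hsum : ∀ x, Cᶜ.indicator f x = ∑ v : f.range, (v : ℝ≥0∞) * (D v).indicator 1 x := by
    intro x
    by_cases hx : x ∈ C
    · rw [indicator_of_notMem (by simpa using hx)]
      symm
      refine Finset.sum_eq_zero fun v _ => ?_
      rw [indicator_of_notMem (fun h => h.2 hx), mul_zero]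
    · rw [indicator_of_mem (by simpa using hx),
        Finset.sum_eq_single (⟨f x, f.mem_range_self x⟩ : f.range)]
      · rw [indicator_of_mem (show x ∈ D (f x) from ⟨rfl, hx⟩)]; simp
      · intro v _ hv
        rw [indicator_of_notMem, mul_zero]
        rintro ⟨h, -⟩
        exact hv (Subtype.ext h.symm)
      · simp
  have h1 : ∀ ω, expNeg (∑' j, Cᶜ.indicator f (X j ω)) =
      ∏ v : f.range, expNeg (v * (pointCount X (D v) ω : ℝ≥0∞)) := by
    intro ω
    rw [← expNeg_sum]
    simp_rw [hsum]
    rw [Summable.tsum_finsetSum fun _ _ => ENNReal.summable]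
    simp_rw [ENNReal.tsum_mul_left, tsum_indicator_eq_pointCount]
  simp_rw [h1]
  refine Eq.trans hprod ?_
  congr 1
  have h2 : ∀ v : f.range, ∫⁻ ω, G (some v) (pointCount X (B (some v)) ω) ∂μ =
      expNeg (ENNReal.ofReal lam * ((1 - expNeg v) * volume (D v))) := by
    intro v
    change ∫⁻ ω, expNeg (v * (pointCount X (D v) ω : ℝ≥0∞)) ∂μ = _
    by_cases hv : (v : ℝ≥0∞) = 0
    · simp [hv]
    · rw [hX.lintegral_expNeg_mul_pointCount hlam (hD v)
        (measure_ne_top_of_subset inter_subset_left (hf _ hv))]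
      congr 1; ring
  rw [Finset.prod_congr rfl fun v _ => h2 v, ← expNeg_sum, ← Finset.mul_sum]
  congr 2
  rw [Finset.sum_coe_sort f.range fun v => (1 - expNeg v) * volume (D v)]
  have h3 := (f.map fun v => 1 - expNeg v).lintegral_eq_lintegral (volume.restrict Cᶜ)
  rw [SimpleFunc.map_lintegral] at h3
  simp only [SimpleFunc.map_apply] at h3
  rw [h3]
  refine Finset.sum_congr rfl fun v _ => ?_
  rw [Measure.restrict_apply (f.measurableSet_fiber v)]

end IsPoissonProcess

end

/-! ### Palm formula of a Poisson process -/

section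

/-- The sum of `f` over the points of the configuration `x` other than the `i`-th one. -/
def sumOthers (f : Plane → ℝ≥0∞) (x : ℕ → Plane) (i : ℕ) : ℝ≥0∞ :=
  ∑' j, if j = i then 0 else f (x j)

lemma tsum_eq_add_sumOthers (f : Plane → ℝ≥0∞) (x : ℕ → Plane) (i : ℕ) :
    ∑' j, f (x j) = f (x i) + sumOthers f x i := by
  rw [sumOthers]
  convert! ENNReal.tsum_eq_add_tsum_ite (f := fun j => f (x j)) i

lemma sumOthers_add (f g : Plane → ℝ≥0∞) (x : ℕ → Plane) (i : ℕ) :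
    sumOthers (fun y => f y + g y) x i = sumOthers f x i + sumOthers g x i := by
  rw [sumOthers, sumOthers, sumOthers, ← ENNReal.tsum_add]
  refine tsum_congr fun j => ?_
  split_ifs <;> simp

lemma tendsto_tsum_of_monotone {g : ℕ → ℕ → ℝ≥0∞} {h : ℕ → ℝ≥0∞}
    (hg : ∀ j, Monotone fun n => g n j)
    (hgh : ∀ j, Tendsto (fun n => g n j) atTop (𝓝 (h j))) :
    Tendsto (fun n => ∑' j, g n j) atTop (𝓝 (∑' j, h j)) := by
  simp_rw [← lintegral_count]
  exact lintegral_tendsto_of_tendsto_of_monotone (fun n => .of_discrete)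
    (.of_forall hg) (.of_forall hgh)

lemma tendsto_expNeg_sumOthers {f : ℕ → Plane → ℝ≥0∞} {g : Plane → ℝ≥0∞}
    (hf : ∀ y, Monotone fun n => f n y)
    (hfg : ∀ y, Tendsto (fun n => f n y) atTop (𝓝 (g y))) (x : ℕ → Plane) (i : ℕ) :
    Tendsto (fun n => expNeg (sumOthers (f n) x i)) atTop (𝓝 (expNeg (sumOthers g x i))) := by
  refine (continuous_expNeg.tendsto _).comp (tendsto_tsum_of_monotone (fun j m n hmn => ?_) ?_)
  · dsimp only
    split_ifs
    · exact le_rfl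
    · exact hf _ hmn
  · intro j
    split_ifs
    · exact tendsto_const_nhds
    · exact hfg _

lemma tendsto_expNeg_mul_lintegral {f : ℕ → Plane → ℝ≥0∞} {g : Plane → ℝ≥0∞}
    (hm : ∀ n, Measurable (f n)) (hf : ∀ y, Monotone fun n => f n y)
    (hfg : ∀ y, Tendsto (fun n => f n y) atTop (𝓝 (g y))) (lam : ℝ) :
    Tendsto (fun n => expNeg (ENNReal.ofReal lam * ∫⁻ y, (1 - expNeg (f n y)))) atTop
      (𝓝 (expNeg (ENNReal.ofReal lam * ∫⁻ y, (1 - expNeg (g y))))) := by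
  refine (continuous_expNeg.tendsto _).comp (ENNReal.Tendsto.const_mul ?_
    (.inr ENNReal.ofReal_ne_top))
  refine lintegral_tendsto_of_tendsto_of_monotone
    (fun n => (measurable_const.sub (measurable_expNeg.comp (hm n))).aemeasurable)
    (.of_forall fun y m n hmn => tsub_le_tsub_left (expNeg_antitone (hf y hmn)) _)
    (.of_forall fun y => ?_)
  exact ENNReal.Tendsto.sub tendsto_const_nhds ((continuous_expNeg.tendsto _).comp (hfg y))
    (.inl ENNReal.one_ne_top)

variable {Ω : Type*} [MeasurableSpace Ω] {μ : Measure Ω} {lam : ℝ} {X : ℕ → Ω → Plane}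

lemma measurable_sumOthers_comp (hX : ∀ i, Measurable (X i)) {F : ℝ → Plane → ℝ≥0∞}
    (hF : Measurable (Function.uncurry F)) {ρ : Ω → ℝ} (hρ : Measurable ρ) (i : ℕ) :
    Measurable fun ω => sumOthers (F (ρ ω)) (fun j => X j ω) i := by
  refine Measurable.tsum fun j => ?_
  split_ifs
  · exact measurable_const
  · exact hF.comp (hρ.prodMk (hX j))

/-- An increasing sequence of simple functions with bounded supports that converges to `f`. -/
def boundedApprox (f : Plane → ℝ≥0∞) (n : ℕ) : SimpleFunc Plane ℝ≥0∞ :=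
  (SimpleFunc.eapprox f n).restrict (Metric.closedBall 0 n)

lemma boundedApprox_apply (f : Plane → ℝ≥0∞) (n : ℕ) (y : Plane) :
    boundedApprox f n y =
      (Metric.closedBall (0 : Plane) n).indicator (SimpleFunc.eapprox f n) y := by
  rw [boundedApprox, SimpleFunc.restrict_apply _ measurableSet_closedBall]

lemma monotone_boundedApprox (f : Plane → ℝ≥0∞) (y : Plane) :
    Monotone fun n => boundedApprox f n y := by
  intro m n hmn
  simp only [boundedApprox_apply]
  have hmn' : (m : ℝ) ≤ n := by exact_mod_cast hmn
  exact (indicator_le_indicator (SimpleFunc.monotone_eapprox f hmn y)).trans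
    (indicator_le_indicator_of_subset (Metric.closedBall_subset_closedBall hmn')
      (fun _ => zero_le) y)

lemma tendsto_boundedApprox {f : Plane → ℝ≥0∞} (hf : Measurable f) (y : Plane) :
    Tendsto (fun n => boundedApprox f n y) atTop (𝓝 (f y)) := by
  refine (SimpleFunc.tendsto_eapprox hf y).congr' ?_
  filter_upwards [eventually_ge_atTop ⌈‖y‖⌉₊] with n hn
  rw [boundedApprox_apply, indicator_of_mem]
  simpa using Nat.ceil_le.1 hn

lemma volume_boundedApprox_preimage_ne_top (f : Plane → ℝ≥0∞) (n : ℕ) {v : ℝ≥0∞} (hv : v ≠ 0) :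
    volume (boundedApprox f n ⁻¹' {v}) ≠ ∞ := by
  have hb : volume (Metric.closedBall (0 : Plane) n) ≠ ∞ := measure_closedBall_lt_top.ne
  refine ne_top_of_le_ne_top hb (measure_mono fun y hy => ?_)
  by_contra h
  rw [mem_preimage, boundedApprox_apply, indicator_of_notMem h] at hy
  exact hv hy.symm

namespace IsPoissonProcess

variable [IsProbabilityMeasure μ]

/-- The Laplace functional of a Poisson process. -/
theorem lintegral_expNeg_tsum (hX : IsPoissonProcess μ lam X) (hlam : 0 ≤ lam)
    {f : Plane → ℝ≥0∞} (hf : Measurable f) :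
    ∫⁻ ω, expNeg (∑' j, f (X j ω)) ∂μ =
      expNeg (ENNReal.ofReal lam * ∫⁻ x, (1 - expNeg (f x))) := by
  have h1 : ∀ n, ∫⁻ ω, expNeg (∑' j, boundedApprox f n (X j ω)) ∂μ =
      expNeg (ENNReal.ofReal lam * ∫⁻ x, (1 - expNeg (boundedApprox f n x))) := by
    intro n
    simpa using hX.lintegral_pointCount_mul_expNeg_simpleFunc hlam (boundedApprox f n)
      (fun v hv => volume_boundedApprox_preimage_ne_top f n hv) MeasurableSet.empty (fun _ => 1)
  have hlim := tendsto_expNeg_mul_lintegral (fun n => (boundedApprox f n).measurable)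
    (monotone_boundedApprox f) (tendsto_boundedApprox hf) lam
  simp_rw [← h1] at hlim
  refine tendsto_nhds_unique ?_ hlim
  refine tendsto_lintegral_of_dominated_convergence (fun _ => 1) (fun n => ?_)
    (fun n => .of_forall fun ω => expNeg_le_one _) (by simp) (.of_forall fun ω => ?_)
  · exact measurable_expNeg.comp
      (Measurable.tsum fun j => (boundedApprox f n).measurable.comp (hX.measurable j))
  · exact (continuous_expNeg.tendsto _).comp (tendsto_tsum_of_monotone
      (fun j => monotone_boundedApprox f _) fun j => tendsto_boundedApprox hf _)

lemma tsum_lintegral_indicator (hX : IsPoissonProcess μ lam X) (hlam : 0 ≤ lam) {C : Set Plane}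
    (hC : MeasurableSet C) (hC' : volume C ≠ ∞) :
    ∑' i, ∫⁻ ω, C.indicator 1 (X i ω) ∂μ = ENNReal.ofReal lam * volume C := by
  rw [← lintegral_tsum, ← hX.lintegral_pointCount hlam hC hC']
  swap
  · exact fun i => ((measurable_one.indicator hC).comp (hX.measurable i)).aemeasurable
  simp_rw [tsum_indicator_eq_pointCount]

/-- Dominated convergence for sums over the points of the process in a bounded set. -/
lemma tendsto_tsum_lintegral_indicator_mul (hX : IsPoissonProcess μ lam X) (hlam : 0 ≤ lam)
    {C : Set Plane} (hC : MeasurableSet C) (hC' : volume C ≠ ∞) {K : ℕ → ℕ → Ω → ℝ≥0∞}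
    {L : ℕ → Ω → ℝ≥0∞} (hK : ∀ n i, Measurable (K n i)) (hK1 : ∀ n i ω, K n i ω ≤ 1)
    (hKL : ∀ i ω, Tendsto (fun n => K n i ω) atTop (𝓝 (L i ω))) :
    Tendsto (fun n => ∑' i, ∫⁻ ω, C.indicator 1 (X i ω) * K n i ω ∂μ) atTop
      (𝓝 (∑' i, ∫⁻ ω, C.indicator 1 (X i ω) * L i ω ∂μ)) := by
  have hm : ∀ i, Measurable fun ω => C.indicator (1 : Plane → ℝ≥0∞) (X i ω) := fun i =>
    (measurable_one.indicator hC).comp (hX.measurable i)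
  have hb : ∀ n i ω, C.indicator (1 : Plane → ℝ≥0∞) (X i ω) * K n i ω ≤ C.indicator 1 (X i ω) :=
    fun n i ω => mul_le_of_le_one_right' (hK1 n i ω)
  have hC1 : ∀ x, C.indicator (1 : Plane → ℝ≥0∞) x ≤ 1 := fun x =>
    indicator_le_self' (f := (1 : Plane → ℝ≥0∞)) (fun _ _ => zero_le) x
  simp_rw [← lintegral_count]
  refine tendsto_lintegral_of_dominated_convergence
    (fun i => ∫⁻ ω, C.indicator 1 (X i ω) ∂μ) (fun n => .of_discrete)
    (fun n => .of_forall fun i => lintegral_mono (hb n i)) ?_ (.of_forall fun i => ?_)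
  · rw [lintegral_count, hX.tsum_lintegral_indicator hlam hC hC']
    exact ENNReal.mul_ne_top ENNReal.ofReal_ne_top hC'
  · refine tendsto_lintegral_of_dominated_convergence (fun _ => 1)
      (fun n => (hm i).mul (hK n i)) (fun n => .of_forall fun ω => (hb n i ω).trans ?_) (by simp)
      (.of_forall fun ω => ENNReal.Tendsto.const_mul (hKL i ω) (.inr ?_))
    · exact hC1 _
    · exact ((hC1 _).trans_lt ENNReal.one_lt_top).ne

/-- The Palm formula for the points in a bounded set on which the test function is constant. -/
lemma tsum_lintegral_indicator_mul_expNeg_of_eqOn (hX : IsPoissonProcess μ lam X) (hlam : 0 ≤ lam)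
    (f : SimpleFunc Plane ℝ≥0∞) (hf : ∀ v ≠ 0, volume (f ⁻¹' {v}) ≠ ∞) {C : Set Plane}
    (hC : MeasurableSet C) (hC' : volume C ≠ ∞) {c : ℝ≥0∞} (hc : ∀ x ∈ C, f x = c) :
    ∑' i, ∫⁻ ω, C.indicator 1 (X i ω) * expNeg (sumOthers f (fun j => X j ω) i) ∂μ =
      ENNReal.ofReal lam * volume C *
        expNeg (ENNReal.ofReal lam * ∫⁻ x, (1 - expNeg (f x))) := by
  have hfm : Measurable (Function.uncurry fun _ : ℝ => (f : Plane → ℝ≥0∞)) :=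
    f.measurable.comp measurable_snd
  have hm : ∀ i, Measurable fun ω => C.indicator (1 : Plane → ℝ≥0∞) (X i ω) := fun i =>
    (measurable_one.indicator hC).comp (hX.measurable i)
  rw [← lintegral_tsum]
  swap
  · exact fun i => ((hm i).mul (measurable_expNeg.comp
      (measurable_sumOthers_comp hX.measurable hfm (measurable_const (a := 0)) i))).aemeasurable
  -- `C` contributes a function of the number of its points, and the points outside `C` factor out
  have h1 : ∀ ω i, C.indicator (1 : Plane → ℝ≥0∞) (X i ω) *
        expNeg (sumOthers f (fun j => X j ω) i) =
      C.indicator (1 : Plane → ℝ≥0∞) (X i ω) * (expNeg (c * ((pointCount X C ω : ℝ≥0∞) - 1)) *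
        expNeg (∑' j, Cᶜ.indicator f (X j ω))) := by
    intro ω i
    by_cases hi : X i ω ∈ C
    swap
    · simp [indicator_of_notMem hi]
    congr 1
    have e1 : sumOthers f (fun j => X j ω) i =
        c * sumOthers (C.indicator 1) (fun j => X j ω) i +
          sumOthers (Cᶜ.indicator f) (fun j => X j ω) i := by
      have : (f : Plane → ℝ≥0∞) = fun y => c * C.indicator 1 y + Cᶜ.indicator f y := by
        ext y
        by_cases hy : y ∈ C
        · simp [hy, hc y hy]
        · simp [hy]
      conv_lhs => rw [this]
      rw [sumOthers_add]
      congr 1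
      rw [sumOthers, sumOthers, ← ENNReal.tsum_mul_left]
      simp
    have e2 := tsum_eq_add_sumOthers (C.indicator 1) (fun j => X j ω) i
    have e3 := tsum_eq_add_sumOthers (Cᶜ.indicator f) (fun j => X j ω) i
    rw [tsum_indicator_eq_pointCount, indicator_of_mem hi, Pi.one_apply] at e2
    rw [indicator_of_notMem (by simpa using hi), zero_add] at e3
    rw [e1, expNeg_add, ← e3, e2, ENNReal.add_sub_cancel_left ENNReal.one_ne_top]
  simp_rw [h1, ENNReal.tsum_mul_right, tsum_indicator_eq_pointCount, ← mul_assoc]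
  rw [hX.lintegral_pointCount_mul_expNeg_simpleFunc hlam f hf hC
    fun n => (n : ℝ≥0∞) * expNeg (c * ((n : ℝ≥0∞) - 1)),
    hX.lintegral_comp_pointCount hC hC' fun n => (n : ℝ≥0∞) * expNeg (c * ((n : ℝ≥0∞) - 1))]
  have h2 : ∀ k : ℕ, expNeg (c * (((k : ℕ∞) : ℝ≥0∞) - 1)) = expNeg c ^ (k - 1) := by
    intro k
    rw [← expNeg_mul_natCast, ENat.toENNReal_coe, ENNReal.natCast_sub, Nat.cast_one]
  simp_rw [h2, ENat.toENNReal_coe]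
  rw [tsum_poissonMeasure_mul_natCast_mul_pow _ (expNeg_le_one c), coe_toNNReal_mul hlam hC',
    mul_assoc, ← expNeg_add, mul_assoc (ENNReal.ofReal lam) (volume C) (1 - _), ← mul_add,
    ← lintegral_add_compl (μ := volume) (fun x => 1 - expNeg (f x)) hC,
    setLIntegral_congr_fun hC (g := fun _ => 1 - expNeg c) fun x hx => by simp [hc x hx],
    setLIntegral_const, mul_comm (1 - expNeg c)]

/-- The Palm formula of a Poisson process: seen from one of its points, the other points form a
Poisson process of the same density. -/
theorem tsum_lintegral_indicator_mul_expNeg (hX : IsPoissonProcess μ lam X) (hlam : 0 ≤ lam)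
    {f : Plane → ℝ≥0∞} (hf : Measurable f) {C : Set Plane}
    (hC : MeasurableSet C) (hC' : volume C ≠ ∞) :
    ∑' i, ∫⁻ ω, C.indicator 1 (X i ω) * expNeg (sumOthers f (fun j => X j ω) i) ∂μ =
      ENNReal.ofReal lam * volume C *
        expNeg (ENNReal.ofReal lam * ∫⁻ x, (1 - expNeg (f x))) := by
  have hmeas : ∀ n i, Measurable fun ω =>
      expNeg (sumOthers (boundedApprox f n) (fun j => X j ω) i) := fun n i =>
    measurable_expNeg.comp (measurable_sumOthers_comp hX.measurable
      (F := fun _ => boundedApprox f n) ((boundedApprox f n).measurable.comp measurable_snd)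
      (measurable_const (a := 0)) i)
  have h1 : ∀ n, ∑' i, ∫⁻ ω, C.indicator 1 (X i ω) *
        expNeg (sumOthers (boundedApprox f n) (fun j => X j ω) i) ∂μ =
      ENNReal.ofReal lam * volume C *
        expNeg (ENNReal.ofReal lam * ∫⁻ x, (1 - expNeg (boundedApprox f n x))) := by
    intro n
    set g := boundedApprox f n
    have hD : ∀ v, MeasurableSet (C ∩ g ⁻¹' {v}) := fun v => hC.inter (g.measurableSet_fiber v)
    have hsum : ∀ x, C.indicator (1 : Plane → ℝ≥0∞) x =
        ∑ v ∈ g.range, (C ∩ g ⁻¹' {v}).indicator 1 x := by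
      intro x
      by_cases hx : x ∈ C
      · rw [Finset.sum_eq_single (g x)]
        · rw [indicator_of_mem hx, indicator_of_mem (show x ∈ C ∩ g ⁻¹' {g x} from ⟨hx, rfl⟩)]
        · intro v _ hv
          exact indicator_of_notMem (fun h => hv h.2.symm) _
        · exact fun h => absurd (g.mem_range_self x) h
      · rw [indicator_of_notMem hx]
        exact (Finset.sum_eq_zero fun v _ => indicator_of_notMem (fun h => hx h.1) _).symm
    have hvol : volume C = ∑ v ∈ g.range, volume (C ∩ g ⁻¹' {v}) := by
      rw [← lintegral_indicator_one hC, lintegral_congr hsum,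
        lintegral_finsetSum _ fun v _ => measurable_one.indicator (hD v)]
      simp_rw [lintegral_indicator_one (hD _)]
    simp_rw [hsum, Finset.sum_mul]
    have hint : ∀ i, ∫⁻ ω, ∑ v ∈ g.range, (C ∩ g ⁻¹' {v}).indicator 1 (X i ω) *
          expNeg (sumOthers g (fun j => X j ω) i) ∂μ =
        ∑ v ∈ g.range, ∫⁻ ω, (C ∩ g ⁻¹' {v}).indicator 1 (X i ω) *
          expNeg (sumOthers g (fun j => X j ω) i) ∂μ := fun i =>
      lintegral_finsetSum _ fun v _ =>
        ((measurable_one.indicator (hD v)).comp (hX.measurable i)).mul (hmeas n i)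
    simp_rw [hint]
    rw [Summable.tsum_finsetSum fun _ _ => ENNReal.summable, hvol, Finset.mul_sum, Finset.sum_mul]
    refine Finset.sum_congr rfl fun v _ => ?_
    exact hX.tsum_lintegral_indicator_mul_expNeg_of_eqOn hlam g
      (fun v hv => volume_boundedApprox_preimage_ne_top f n hv) (hD v)
      (measure_ne_top_of_subset inter_subset_left hC') fun x hx => hx.2
  have hlim := ENNReal.Tendsto.const_mul (a := ENNReal.ofReal lam * volume C)
    (tendsto_expNeg_mul_lintegral (fun n => (boundedApprox f n).measurable)
    (monotone_boundedApprox f) (tendsto_boundedApprox hf) lam)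
    (.inr (ENNReal.mul_ne_top ENNReal.ofReal_ne_top hC'))
  simp_rw [← h1] at hlim
  refine tendsto_nhds_unique ?_ hlim
  exact hX.tendsto_tsum_lintegral_indicator_mul hlam hC hC' hmeas (fun _ _ _ => expNeg_le_one _)
    fun i ω => tendsto_expNeg_sumOthers (monotone_boundedApprox f) (tendsto_boundedApprox hf) _ _

end IsPoissonProcess

end

/-! ### Palm formula with a distance-dependent test function -/

section

/-- The largest multiple of `2⁻ⁿ` below `r ≥ 0`. -/
def dyadicFloor (n : ℕ) (r : ℝ) : ℝ := (⌊2 ^ n * r⌋₊ : ℝ) / 2 ^ n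

lemma dyadicFloor_le (n : ℕ) {r : ℝ} (hr : 0 ≤ r) : dyadicFloor n r ≤ r := by
  rw [dyadicFloor, div_le_iff₀ (by positivity), mul_comm]
  exact Nat.floor_le (by positivity)

lemma monotone_dyadicFloor {r : ℝ} (hr : 0 ≤ r) : Monotone fun n => dyadicFloor n r := by
  refine monotone_nat_of_le_succ fun n => ?_
  rw [dyadicFloor, dyadicFloor, div_le_div_iff₀ (by positivity) (by positivity), pow_succ,
    ← mul_assoc, mul_right_comm]
  refine mul_le_mul_of_nonneg_right ?_ (by positivity)
  have h : ⌊2 ^ n * r⌋₊ * 2 ≤ ⌊2 ^ n * 2 * r⌋₊ := by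
    refine Nat.le_floor ?_
    have := Nat.floor_le (show 0 ≤ 2 ^ n * r by positivity)
    push_cast
    nlinarith
  exact_mod_cast h

lemma tendsto_dyadicFloor {r : ℝ} (hr : 0 ≤ r) :
    Tendsto (fun n => dyadicFloor n r) atTop (𝓝[≤] r) := by
  refine tendsto_nhdsWithin_iff.2 ⟨?_, .of_forall fun n => dyadicFloor_le n hr⟩
  have h0 : Tendsto (fun n : ℕ => r - (1 / 2 : ℝ) ^ n) atTop (𝓝 (r - 0)) :=
    tendsto_const_nhds.sub (tendsto_pow_atTop_nhds_zero_of_lt_one (by norm_num) (by norm_num))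
  rw [sub_zero] at h0
  refine tendsto_of_tendsto_of_tendsto_of_le_of_le h0 tendsto_const_nhds (fun n => ?_)
    fun n => dyadicFloor_le n hr
  have := Nat.lt_floor_add_one (2 ^ n * r)
  simp only [dyadicFloor, one_div, inv_pow]
  rw [le_div_iff₀ (by positivity), sub_mul, inv_mul_cancel₀ (by positivity)]
  linarith

lemma measurable_dyadicFloor (n : ℕ) : Measurable (dyadicFloor n) := by
  unfold dyadicFloor
  have : Measurable fun r : ℝ => ⌊2 ^ n * r⌋₊ := Nat.measurable_floor.comp (by fun_prop)
  exact (measurable_from_nat.comp this).div_const _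

namespace IsPoissonProcess

variable {Ω : Type*} [MeasurableSpace Ω] {μ : Measure Ω} {lam : ℝ} {X : ℕ → Ω → Plane}
variable [IsProbabilityMeasure μ]

/-- The Palm formula when the test function of the other points depends on the dyadic
discretization of the distance of the distinguished point. -/
lemma tsum_lintegral_indicator_mul_expNeg_dyadicFloor (hX : IsPoissonProcess μ lam X)
    (hlam : 0 ≤ lam) {F : ℝ → Plane → ℝ≥0∞} (hF : Measurable (Function.uncurry F)) {C : Set Plane}
    (hC : MeasurableSet C) (hC' : volume C ≠ ∞) (n : ℕ) :
    ∑' i, ∫⁻ ω, C.indicator 1 (X i ω) *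
        expNeg (sumOthers (F (dyadicFloor n ‖X i ω‖)) (fun j => X j ω) i) ∂μ =
      ENNReal.ofReal lam * ∫⁻ x in C,
        expNeg (ENNReal.ofReal lam * ∫⁻ y, (1 - expNeg (F (dyadicFloor n ‖x‖) y))) := by
  let q : Plane → ℕ := fun x => ⌊2 ^ n * ‖x‖⌋₊
  have hq : Measurable q := Nat.measurable_floor.comp (by fun_prop)
  let D : ℕ → Set Plane := fun k => C ∩ q ⁻¹' {k}
  have hD : ∀ k, MeasurableSet (D k) := fun k => hC.inter (hq (measurableSet_singleton k))
  have hsum : ∀ (A : ℕ → ℝ≥0∞) (x : Plane),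
      C.indicator 1 x * A (q x) = ∑' k, (D k).indicator 1 x * A k := by
    intro A x
    rw [tsum_eq_single (q x)]
    · by_cases hx : x ∈ C
      · rw [indicator_of_mem hx, indicator_of_mem (show x ∈ D (q x) from ⟨hx, rfl⟩)]
      · rw [indicator_of_notMem hx, indicator_of_notMem fun h => hx h.1]
    · intro k hk
      rw [indicator_of_notMem (fun h => hk h.2.symm), zero_mul]
  have hm : ∀ i k, Measurable fun ω => (D k).indicator (1 : Plane → ℝ≥0∞) (X i ω) *
      expNeg (sumOthers (F (k / 2 ^ n)) (fun j => X j ω) i) := fun i k =>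
    ((measurable_one.indicator (hD k)).comp (hX.measurable i)).mul
      (measurable_expNeg.comp (measurable_sumOthers_comp hX.measurable hF measurable_const i))
  have hleft : ∀ i, ∫⁻ ω, C.indicator 1 (X i ω) *
        expNeg (sumOthers (F (dyadicFloor n ‖X i ω‖)) (fun j => X j ω) i) ∂μ =
      ∑' k : ℕ, ∫⁻ ω, (D k).indicator 1 (X i ω) *
        expNeg (sumOthers (F (k / 2 ^ n)) (fun j => X j ω) i) ∂μ := by
    intro i
    rw [← lintegral_tsum fun k => (hm i k).aemeasurable]
    exact lintegral_congr fun ω =>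
      hsum (fun k => expNeg (sumOthers (F (k / 2 ^ n)) (fun j => X j ω) i)) (X i ω)
  simp_rw [hleft]
  rw [ENNReal.tsum_comm]
  have hpalm := fun k : ℕ => hX.tsum_lintegral_indicator_mul_expNeg hlam
    (f := F (k / 2 ^ n)) (hF.comp measurable_prodMk_left) (hD k)
    (measure_ne_top_of_subset inter_subset_left hC')
  simp_rw [hpalm, mul_assoc]
  rw [ENNReal.tsum_mul_left, ← lintegral_indicator hC]
  congr 1
  have hright : ∀ x, C.indicator (fun x =>
        expNeg (ENNReal.ofReal lam * ∫⁻ y, (1 - expNeg (F (dyadicFloor n ‖x‖) y)))) x =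
      ∑' k : ℕ, (D k).indicator 1 x *
        expNeg (ENNReal.ofReal lam * ∫⁻ y, (1 - expNeg (F (k / 2 ^ n) y))) := by
    intro x
    rw [← hsum fun k => expNeg (ENNReal.ofReal lam * ∫⁻ y, (1 - expNeg (F (k / 2 ^ n) y)))]
    by_cases hx : x ∈ C
    · simp only [indicator_of_mem hx, Pi.one_apply, one_mul]
      rfl
    · simp [indicator_of_notMem hx]
  simp_rw [hright]
  rw [lintegral_tsum fun k => ((measurable_one.indicator (hD k)).mul_const _).aemeasurable]
  refine tsum_congr fun k => ?_
  rw [lintegral_mul_const _ (measurable_one.indicator (hD k)), lintegral_indicator_one (hD k)]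

/-- The Palm formula when the test function of the other points depends, monotonically and
left-continuously, on the distance of the distinguished point. -/
lemma tsum_lintegral_indicator_mul_expNeg_norm (hX : IsPoissonProcess μ lam X)
    (hlam : 0 ≤ lam) {F : ℝ → Plane → ℝ≥0∞} (hF : Measurable (Function.uncurry F))
    (hmono : ∀ y, Monotone fun r => F r y)
    (hcont : ∀ y r, ContinuousWithinAt (fun r => F r y) (Iic r) r)
    {C : Set Plane} (hC : MeasurableSet C) (hC' : volume C ≠ ∞) :
    ∑' i, ∫⁻ ω, C.indicator 1 (X i ω) *
        expNeg (sumOthers (F ‖X i ω‖) (fun j => X j ω) i) ∂μ =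
      ENNReal.ofReal lam * ∫⁻ x in C,
        expNeg (ENNReal.ofReal lam * ∫⁻ y, (1 - expNeg (F ‖x‖ y))) := by
  have hmono' : ∀ (x y : Plane), Monotone fun n => F (dyadicFloor n ‖x‖) y := fun x y =>
    (hmono y).comp (monotone_dyadicFloor (norm_nonneg x))
  have hlim : ∀ (x y : Plane), Tendsto (fun n => F (dyadicFloor n ‖x‖) y) atTop (𝓝 (F ‖x‖ y)) :=
    fun x y => (hcont y _).tendsto.comp (tendsto_dyadicFloor (norm_nonneg x))
  have hright : Tendsto (fun n => ENNReal.ofReal lam * ∫⁻ x in C,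
        expNeg (ENNReal.ofReal lam * ∫⁻ y, (1 - expNeg (F (dyadicFloor n ‖x‖) y)))) atTop
      (𝓝 (ENNReal.ofReal lam * ∫⁻ x in C,
        expNeg (ENNReal.ofReal lam * ∫⁻ y, (1 - expNeg (F ‖x‖ y))))) := by
    refine ENNReal.Tendsto.const_mul ?_ (.inr ENNReal.ofReal_ne_top)
    refine tendsto_lintegral_of_dominated_convergence (fun _ => 1) (fun n => ?_)
      (fun n => .of_forall fun x => expNeg_le_one _) (by simpa using hC')
      (.of_forall fun x => tendsto_expNeg_mul_lintegral (fun n => hF.comp measurable_prodMk_left)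
        (hmono' x) (hlim x) lam)
    refine measurable_expNeg.comp (measurable_const.mul (Measurable.lintegral_prod_right' (f :=
      fun p : Plane × Plane => 1 - expNeg (F (dyadicFloor n ‖p.1‖) p.2)) ?_))
    exact measurable_const.sub (measurable_expNeg.comp (hF.comp
      (((measurable_dyadicFloor n).comp measurable_fst.norm).prodMk measurable_snd)))
  simp_rw [← hX.tsum_lintegral_indicator_mul_expNeg_dyadicFloor hlam hF hC hC'] at hright
  refine tendsto_nhds_unique ?_ hright
  refine hX.tendsto_tsum_lintegral_indicator_mul hlam hC hC' (fun n i => ?_)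
    (fun _ _ _ => expNeg_le_one _)
    fun i ω => tendsto_expNeg_sumOthers (hmono' _) (hlim _) _ _
  exact measurable_expNeg.comp (measurable_sumOthers_comp hX.measurable hF
    ((measurable_dyadicFloor n).comp (hX.measurable i).norm) i)

/-- The Palm formula of a Poisson process for a functional of a point and of the other points, in
which the test function of the others may depend on the distance of the distinguished point. -/
theorem tsum_lintegral_mul_expNeg_norm (hX : IsPoissonProcess μ lam X)
    (hlam : 0 ≤ lam) {F : ℝ → Plane → ℝ≥0∞} (hF : Measurable (Function.uncurry F))
    (hmono : ∀ y, Monotone fun r => F r y)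
    (hcont : ∀ y r, ContinuousWithinAt (fun r => F r y) (Iic r) r)
    {u : Plane → ℝ≥0∞} (hu : Measurable u) :
    ∑' i, ∫⁻ ω, u (X i ω) * expNeg (sumOthers (F ‖X i ω‖) (fun j => X j ω) i) ∂μ =
      ENNReal.ofReal lam * ∫⁻ x, u x *
        expNeg (ENNReal.ofReal lam * ∫⁻ y, (1 - expNeg (F ‖x‖ y))) := by
  let W : ℕ → Ω → ℝ≥0∞ := fun i ω => expNeg (sumOthers (F ‖X i ω‖) (fun j => X j ω) i)
  let L : Plane → ℝ≥0∞ := fun x => expNeg (ENNReal.ofReal lam * ∫⁻ y, (1 - expNeg (F ‖x‖ y)))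
  have hW : ∀ i, Measurable (W i) := fun i =>
    measurable_expNeg.comp (measurable_sumOthers_comp hX.measurable hF (hX.measurable i).norm i)
  have hL : Measurable L := by
    refine measurable_expNeg.comp (measurable_const.mul (Measurable.lintegral_prod_right' (f :=
      fun p : Plane × Plane => 1 - expNeg (F ‖p.1‖ p.2)) ?_))
    exact measurable_const.sub (measurable_expNeg.comp (hF.comp
      (measurable_fst.norm.prodMk measurable_snd)))
  -- both sides are integrals of `u`, and the two measures agree on bounded sets
  let M : Measure Plane := Measure.sum fun i => (μ.withDensity (W i)).map (X i)
  let M' : Measure Plane := ENNReal.ofReal lam • volume.withDensity L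
  have hM : ∀ v : Plane → ℝ≥0∞, Measurable v →
      ∫⁻ x, v x ∂M = ∑' i, ∫⁻ ω, v (X i ω) * W i ω ∂μ := by
    intro v hv
    rw [lintegral_sum_measure]
    refine tsum_congr fun i => ?_
    rw [lintegral_map hv (hX.measurable i)]
    refine (lintegral_withDensity_eq_lintegral_mul μ (hW i) (hv.comp (hX.measurable i))).trans ?_
    exact lintegral_congr fun ω => mul_comm _ _
  have hM' : ∀ v : Plane → ℝ≥0∞, Measurable v →
      ∫⁻ x, v x ∂M' = ENNReal.ofReal lam * ∫⁻ x, v x * L x := by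
    intro v hv
    rw [lintegral_smul_measure, lintegral_withDensity_eq_lintegral_mul _ hL hv, smul_eq_mul]
    congr 1
    exact lintegral_congr fun ω => mul_comm _ _
  have hbdd : ∀ C, MeasurableSet C → volume C ≠ ∞ → M C = M' C := by
    intro C hC hC'
    rw [← lintegral_indicator_one hC, ← lintegral_indicator_one hC,
      hM _ (measurable_one.indicator hC), hM' _ (measurable_one.indicator hC)]
    refine (hX.tsum_lintegral_indicator_mul_expNeg_norm hlam hF hmono hcont hC hC').trans ?_
    rw [← lintegral_indicator hC]
    congr 1
    refine lintegral_congr fun x => ?_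
    by_cases hx : x ∈ C <;> simp [hx, L]
  have heq : M = M' := by
    ext s hs
    have hmon : Monotone fun n : ℕ => s ∩ Metric.closedBall (0 : Plane) n := fun m n hmn =>
      inter_subset_inter_right _ (Metric.closedBall_subset_closedBall (by exact_mod_cast hmn))
    have hs' : s = ⋃ n : ℕ, s ∩ Metric.closedBall (0 : Plane) n := by
      rw [← inter_iUnion, Metric.iUnion_closedBall_nat, inter_univ]
    have hball : ∀ n : ℕ, volume (Metric.closedBall (0 : Plane) n) ≠ ∞ := fun n =>
      measure_closedBall_lt_top.ne
    rw [hs', hmon.measure_iUnion, hmon.measure_iUnion]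
    exact iSup_congr fun n => hbdd _ (hs.inter measurableSet_closedBall)
      (ne_top_of_le_ne_top (hball n) (measure_mono inter_subset_right))
  rw [← hM u hu, ← hM' u hu, heq]

end IsPoissonProcess

end

/-! ### Exponential fading and thinning -/

section

/-- The Laplace transform at `c` of an exponential variable of mean `1` that is kept with
probability `p` and replaced by `0` otherwise. -/
def thinnedLaplace (p c : ℝ≥0∞) : ℝ≥0∞ := p * (1 + c)⁻¹ + (1 - p)

lemma thinnedLaplace_le_one {p : ℝ≥0∞} (hp : p ≤ 1) (c : ℝ≥0∞) : thinnedLaplace p c ≤ 1 := by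
  calc p * (1 + c)⁻¹ + (1 - p) ≤ p * 1 + (1 - p) := by
        gcongr
        exact ENNReal.inv_le_one.2 le_self_add
    _ = 1 := by rw [mul_one, add_tsub_cancel_of_le hp]

lemma thinnedLaplace_antitone (p : ℝ≥0∞) : Antitone (thinnedLaplace p) := fun c d h => by
  unfold thinnedLaplace
  gcongr

lemma continuous_thinnedLaplace {p : ℝ≥0∞} (hp : p ≤ 1) : Continuous (thinnedLaplace p) := by
  unfold thinnedLaplace
  have hp' : p ≠ ∞ := (hp.trans_lt ENNReal.one_lt_top).ne
  exact ((ENNReal.continuous_const_mul hp').comp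
    (continuous_inv.comp (continuous_const.add continuous_id))).add continuous_const

lemma one_sub_thinnedLaplace {p : ℝ≥0∞} (hp : p ≤ 1) (c : ℝ≥0∞) :
    1 - thinnedLaplace p c = p * (1 - (1 + c)⁻¹) := by
  have hp' : p ≠ ∞ := (hp.trans_lt ENNReal.one_lt_top).ne
  have hc : (1 + c)⁻¹ ≤ 1 := ENNReal.inv_le_one.2 le_self_add
  refine ENNReal.sub_eq_of_eq_add
    ((thinnedLaplace_le_one hp c).trans_lt ENNReal.one_lt_top).ne ?_
  rw [thinnedLaplace, ← add_assoc, ← mul_add, tsub_add_cancel_of_le hc, mul_one,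
    add_tsub_cancel_of_le hp]

lemma expMeasure_one_setOf_lt_ofReal (v : ℝ≥0∞) :
    expMeasure 1 {x | v < ENNReal.ofReal x} = expNeg v := by
  have := isProbabilityMeasure_expMeasure one_pos
  induction v with
  | top => simp
  | coe t =>
    have h1 : {x : ℝ | (t : ℝ≥0∞) < ENNReal.ofReal x} = (Iic (t : ℝ))ᶜ := by
      ext x
      rw [mem_ofPred_eq, compl_Iic, mem_Ioi, ← ENNReal.ofReal_coe_nnreal,
        ENNReal.ofReal_lt_ofReal_iff_of_nonneg t.coe_nonneg]
    rw [h1, prob_compl_eq_one_sub measurableSet_Iic, ← ofReal_cdf, cdf_expMeasure_eq one_pos,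
      if_pos t.coe_nonneg, ← ENNReal.ofReal_one, ← ENNReal.ofReal_sub, one_mul, sub_sub_cancel,
      ← expNeg_ofReal t.coe_nonneg, ENNReal.ofReal_coe_nnreal]
    rw [one_mul, sub_nonneg, Real.exp_le_one_iff]
    simp

lemma lintegral_expMeasure_one_expNeg (c : ℝ≥0∞) :
    ∫⁻ x, expNeg (ENNReal.ofReal x * c) ∂expMeasure 1 = (1 + c)⁻¹ := by
  have hpdf : ∀ r, Measurable (exponentialPDF r) := fun r =>
    (measurable_exponentialPDFReal r).ennreal_ofReal
  have hm : Measurable fun x => expNeg (ENNReal.ofReal x * c) :=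
    measurable_expNeg.comp (ENNReal.measurable_ofReal.mul_const c)
  have h0 : ∫⁻ x, expNeg (ENNReal.ofReal x * c) ∂expMeasure 1 =
      ∫⁻ x, exponentialPDF 1 x * expNeg (ENNReal.ofReal x * c) :=
    lintegral_withDensity_eq_lintegral_mul volume (hpdf 1) hm
  rw [h0]
  induction c with
  | top =>
    rw [add_top, ENNReal.inv_top]
    refine (lintegral_eq_zero_iff ((hpdf 1).mul hm)).2 ?_
    have : ∀ᵐ x : ℝ, x ≠ 0 := by simp [ae_iff]
    filter_upwards [this] with x hx
    rcases hx.lt_or_gt with h | h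
    · simp [exponentialPDF_of_neg h]
    · simp [ENNReal.mul_top, h]
  | coe t =>
    have hr : 0 < 1 + (t : ℝ) := by positivity
    -- tilting the density of rate `1` by `exp (-t x)` gives
    -- a multiple of the density of rate `1 + t`
    have h1 : ∀ x, exponentialPDF 1 x * expNeg (ENNReal.ofReal x * t) =
        ENNReal.ofReal (1 + t)⁻¹ * exponentialPDF (1 + t) x := by
      intro x
      rcases lt_or_ge x 0 with h | h
      · simp [exponentialPDF_of_neg h]
      · rw [exponentialPDF_of_nonneg h, exponentialPDF_of_nonneg h, ← ENNReal.ofReal_coe_nnreal,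
          ← ENNReal.ofReal_mul h, expNeg_ofReal (by positivity),
          ← ENNReal.ofReal_mul (by positivity), ← ENNReal.ofReal_mul (by positivity), one_mul,
          one_mul, ← Real.exp_add, inv_mul_cancel_left₀ hr.ne']
        congr 2; ring
    simp_rw [h1]
    rw [lintegral_const_mul _ (hpdf _), lintegral_exponentialPDF_eq_one hr, mul_one,
      ENNReal.ofReal_inv_of_pos hr, ENNReal.ofReal_add zero_le_one t.coe_nonneg,
      ENNReal.ofReal_one, ENNReal.ofReal_coe_nnreal]

lemma measurable_biSup_of_source {β : Type*} [MeasurableSpace β] {Ω : Type*} (S : Network Ω)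
    {T : Set Source}
    {s : Source} (hs : s ∈ T) {f : Ω → β} (hf : Measurable[S.sigmaAlgebra s] f) :
    Measurable[⨆ t ∈ T, S.sigmaAlgebra t] f :=
  hf.mono (le_biSup S.sigmaAlgebra hs) le_rfl

lemma measurable_ite_fading {Ω : Type*} {m : MeasurableSpace Ω} {a : Ω → Bool} {h : Ω → ℝ}
    (ha : Measurable[m] a) (hh : Measurable[m] h) (c : ℝ≥0∞) :
    Measurable[m] fun ω => if a ω = true then ENNReal.ofReal (h ω) * c else 0 :=
  Measurable.ite (ha (measurableSet_singleton true)) (hh.ennreal_ofReal.mul_const c)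
    measurable_const

lemma measurable_tsum_inl_add_tsum_inr {Ω : Type*} {m : MeasurableSpace Ω}
    {V : ℕ ⊕ ℕ → Ω → ℝ≥0∞} (hV : ∀ k, Measurable (V k)) :
    Measurable fun ω => (∑' j, V (.inl j) ω) + ∑' j, V (.inr j) ω :=
  (Measurable.tsum fun j => hV (.inl j)).add (Measurable.tsum fun j => hV (.inr j))

variable {Ω : Type*} [mΩ : MeasurableSpace Ω] {μ : Measure Ω}

lemma Network.IsModel.sigmaAlgebra_le {S : Network Ω} {lamB lamF zeta q : ℝ}
    (hS : S.IsModel μ lamB lamF zeta q) (s : Source) :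
    S.sigmaAlgebra s ≤ mΩ := by
  cases s with
  | macroPositions => exact (measurable_pi_lambda _ hS.macro_poisson.measurable).comap_le
  | femtoPositions => exact (measurable_pi_lambda _ hS.femto_poisson.measurable).comap_le
  | macroFading i => exact (hS.macro_fading_measurable i).comap_le
  | femtoFading i => exact (hS.femto_fading_measurable i).comap_le
  | macroActivity i => exact (hS.macro_active_measurable i).comap_le
  | femtoActivity i => exact (hS.femto_active_measurable i).comap_le

variable [IsProbabilityMeasure μ]

lemma measure_lt_ofReal_of_hasLaw_expMeasure {h : Ω → ℝ} {V : Ω → ℝ≥0∞}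
    (hh : HasLaw h (expMeasure 1) μ) (hV : Measurable V) (hind : V ⟂ᵢ[μ] h) :
    μ {ω | V ω < ENNReal.ofReal (h ω)} = ∫⁻ ω, expNeg (V ω) ∂μ := by
  have := isProbabilityMeasure_expMeasure one_pos
  have hmap := (indepFun_iff_map_prod_eq_prod_map_map hV.aemeasurable hh.aemeasurable).1 hind
  have hs : MeasurableSet {p : ℝ≥0∞ × ℝ | p.1 < ENNReal.ofReal p.2} :=
    measurableSet_lt measurable_fst measurable_snd.ennreal_ofReal
  have h1 : μ {ω | V ω < ENNReal.ofReal (h ω)} =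
      μ.map (fun ω => (V ω, h ω)) {p | p.1 < ENNReal.ofReal p.2} := by
    rw [Measure.map_apply_of_aemeasurable (hV.aemeasurable.prodMk hh.aemeasurable) hs]
    rfl
  rw [h1, hmap, hh.map_eq, Measure.prod_apply hs, lintegral_map ?_ hV]
  · exact lintegral_congr fun ω => expMeasure_one_setOf_lt_ofReal (V ω)
  · exact measurable_measure_prodMk_left hs

lemma lintegral_expNeg_ite_fading {h : Ω → ℝ} {a : Ω → Bool} {p : ℝ≥0∞}
    (hh : HasLaw h (expMeasure 1) μ) (hhm : Measurable h) (ham : Measurable a)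
    (ha : μ {ω | a ω = true} = p) (hind : a ⟂ᵢ[μ] h) (c : ℝ≥0∞) :
    ∫⁻ ω, expNeg (if a ω = true then ENNReal.ofReal (h ω) * c else 0) ∂μ =
      thinnedLaplace p c := by
  have has : MeasurableSet {ω | a ω = true} := ham (measurableSet_singleton true)
  have hm : Measurable fun x => expNeg (ENNReal.ofReal x * c) :=
    measurable_expNeg.comp (ENNReal.measurable_ofReal.mul_const c)
  have h1 : ∀ ω, expNeg (if a ω = true then ENNReal.ofReal (h ω) * c else 0) =
      ({true} : Set Bool).indicator 1 (a ω) * expNeg (ENNReal.ofReal (h ω) * c) +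
        ({ω | a ω = true}ᶜ).indicator 1 ω := by
    intro ω
    by_cases hω : a ω = true <;> simp [hω]
  have hb : Measurable (({true} : Set Bool).indicator (1 : Bool → ℝ≥0∞)) := .of_discrete
  simp_rw [h1]
  rw [lintegral_add_right _ (measurable_one.indicator has.compl),
    lintegral_indicator_one has.compl, prob_compl_eq_one_sub has, ha]
  have h2 := lintegral_mul_eq_lintegral_mul_lintegral_of_indepFun (hb.comp ham) (hm.comp hhm)
    (hind.comp hb hm)
  simp only [Pi.mul_apply, Function.comp_apply] at h2
  rw [h2, ← lintegral_map hm hhm, hh.map_eq, lintegral_expMeasure_one_expNeg, thinnedLaplace]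
  congr 2
  rw [← ha, ← lintegral_indicator_one has]
  rfl

/-- Functions of pairwise disjoint groups of independent sources are independent. -/
lemma lintegral_prod_eq_prod_lintegral_of_disjoint {ι κ : Type*} {m : ι → MeasurableSpace Ω}
    (hm : ∀ i, m i ≤ mΩ) (hind : iIndep m μ) {T : κ → Set ι}
    (hT : Pairwise fun k l => Disjoint (T k) (T l)) {Y : κ → Ω → ℝ≥0∞}
    (hY : ∀ k, Measurable[⨆ i ∈ T k, m i] (Y k)) (s : Finset κ) :
    ∫⁻ ω, ∏ k ∈ s, Y k ω ∂μ = ∏ k ∈ s, ∫⁻ ω, Y k ω ∂μ := by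
  induction s using Finset.cons_induction with
  | empty => simp
  | cons k s hk ih =>
    simp only [Finset.prod_cons]
    rw [← ih]
    refine lintegral_mul_eq_lintegral_mul_lintegral_of_independent_measurableSpace
      (iSup₂_le fun i _ => hm i) (iSup₂_le fun i _ => hm i)
      (indep_iSup_of_disjoint hm hind (S := T k) (T := ⋃ l ∈ s, T l) ?_) (hY k) ?_
    · rw [disjoint_iUnion₂_right]
      exact fun l hl => hT fun h => hk (h ▸ hl)
    · refine Finset.measurable_prod s fun l hl => (hY l).mono ?_ le_rfl
      exact biSup_mono fun i hi => mem_biUnion hl hi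

namespace Network.IsModel

variable {S : Network Ω} {lamB lamF zeta q : ℝ}

/-- For frozen positions, the probability that the fading of the `i`-th macro station exceeds the
interference, in which `c j` and `d j` are the relative path losses of the stations. -/
theorem measure_interference_lt_fading (hS : S.IsModel μ lamB lamF zeta q)
    (hzeta : zeta ≤ 1) (hq : q ≤ 1) (i : ℕ) (c d : ℕ → ℝ≥0∞) :
    μ {ω | (∑' j, if j ≠ i ∧ S.macroActive j ω = true then
          ENNReal.ofReal (S.macroFading j ω) * c j else 0) +
        (∑' j, if S.femtoActive j ω = true then
          ENNReal.ofReal (S.femtoFading j ω) * d j else 0) <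
        ENNReal.ofReal (S.macroFading i ω)} =
      expNeg ((∑' j, if j = i then 0 else
          negLog (thinnedLaplace (ENNReal.ofReal zeta) (c j))) +
        ∑' j, negLog (thinnedLaplace (ENNReal.ofReal q) (d j))) := by
  have hzeta' : ENNReal.ofReal zeta ≤ 1 := ENNReal.ofReal_le_one.2 hzeta
  have hq' : ENNReal.ofReal q ≤ 1 := ENNReal.ofReal_le_one.2 hq
  let V : ℕ ⊕ ℕ → Ω → ℝ≥0∞ := Sum.elim
    (fun j ω => if j ≠ i ∧ S.macroActive j ω = true then
      ENNReal.ofReal (S.macroFading j ω) * c j else 0)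
    (fun j ω => if S.femtoActive j ω = true then ENNReal.ofReal (S.femtoFading j ω) * d j else 0)
  -- the sources of randomness on which `V k` depends; none of them is the `i`-th macro fading
  let T : ℕ ⊕ ℕ → Set Source := Sum.elim
    (fun j => {s | s ≠ .macroFading i} ∩ {.macroFading j, .macroActivity j})
    (fun j => {.femtoFading j, .femtoActivity j})
  have hV : ∀ k, Measurable[⨆ s ∈ T k, S.sigmaAlgebra s] (V k) := by
    rintro (j | j)
    · by_cases hj : j = i
      · simp only [V, Sum.elim_inl, hj, ne_eq, not_true_eq_false, false_and, if_false]
        exact measurable_const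
      · simp only [V, Sum.elim_inl, ne_eq, hj, not_false_eq_true, true_and]
        refine measurable_ite_fading
          (measurable_biSup_of_source S (s := .macroActivity j) ?_ (comap_measurable _))
          (measurable_biSup_of_source S (s := .macroFading j) ?_ (comap_measurable _)) _
        · simp [T]
        · simp [T, hj]
    · exact measurable_ite_fading
        (measurable_biSup_of_source S (s := .femtoActivity j) (by simp [T]) (comap_measurable _))
        (measurable_biSup_of_source S (s := .femtoFading j) (by simp [T]) (comap_measurable _)) _
  have hT : Pairwise fun k l => Disjoint (T k) (T l) := by
    rintro (j | j) (l | l) hjl <;> rw [Set.disjoint_left] <;> intro s <;> simp only [T] <;>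
      rcases s <;> simp_all
  have hTi : ∀ k, T k ⊆ {.macroFading i}ᶜ := by
    rintro (j | j) s hs
    · exact hs.1
    · rcases hs with rfl | rfl <;> simp
  have hVm : ∀ k, Measurable (V k) := fun k =>
    (hV k).mono (iSup₂_le fun s _ => hS.sigmaAlgebra_le s) le_rfl
  -- the interference is independent of the fading of the `i`-th macro station
  have hind : (fun ω => (∑' j, V (.inl j) ω) + ∑' j, V (.inr j) ω) ⟂ᵢ[μ] S.macroFading i := by
    have h := indep_iSup_of_disjoint hS.sigmaAlgebra_le hS.indep
      (S := {.macroFading i}ᶜ) (T := {.macroFading i}) disjoint_compl_left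
    refine indep_of_indep_of_le_left (indep_of_indep_of_le_right h ?_) ?_
    · exact le_biSup S.sigmaAlgebra (mem_singleton (Source.macroFading i))
    · refine Measurable.comap_le ?_
      have hV' : ∀ k, Measurable[⨆ s ∈ ({.macroFading i}ᶜ : Set Source), S.sigmaAlgebra s] (V k) :=
        fun k => (hV k).mono (biSup_mono fun s hs => hTi k hs) le_rfl
      exact measurable_tsum_inl_add_tsum_inr hV'
  have hVsum : Measurable fun ω => (∑' j, V (.inl j) ω) + ∑' j, V (.inr j) ω :=
    measurable_tsum_inl_add_tsum_inr hVm
  refine (measure_lt_ofReal_of_hasLaw_expMeasure (hS.macro_fading i) hVsum hind).trans ?_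
  let G : ℕ ⊕ ℕ → ℝ≥0∞ := Sum.elim
    (fun j => if j = i then 0 else negLog (thinnedLaplace (ENNReal.ofReal zeta) (c j)))
    (fun j => negLog (thinnedLaplace (ENNReal.ofReal q) (d j)))
  have hG : ∀ k, ∫⁻ ω, expNeg (V k ω) ∂μ = expNeg (G k) := by
    rintro (j | j)
    · by_cases hj : j = i
      · simp [V, G, hj]
      · simp only [V, G, Sum.elim_inl, ne_eq, hj, not_false_eq_true, true_and, if_false]
        rw [expNeg_negLog (thinnedLaplace_le_one hzeta' _)]
        exact lintegral_expNeg_ite_fading (hS.macro_fading j) (hS.macro_fading_measurable j)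
          (hS.macro_active_measurable j) (hS.macro_active j)
          (hS.indep.indep (i := .macroActivity j) (j := .macroFading j) (by simp)) _
    · simp only [V, G, Sum.elim_inr]
      rw [expNeg_negLog (thinnedLaplace_le_one hq' _)]
      exact lintegral_expNeg_ite_fading (hS.femto_fading j) (hS.femto_fading_measurable j)
        (hS.femto_active_measurable j) (hS.femto_active j)
        (hS.indep.indep (i := .femtoActivity j) (j := .femtoFading j) (by simp)) _
  have hfin : ∀ n, ∫⁻ ω, expNeg ((∑ j ∈ Finset.range n, V (.inl j) ω) +
        ∑ j ∈ Finset.range n, V (.inr j) ω) ∂μ =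
      expNeg ((∑ j ∈ Finset.range n, G (.inl j)) + ∑ j ∈ Finset.range n, G (.inr j)) := by
    intro n
    have h := lintegral_prod_eq_prod_lintegral_of_disjoint hS.sigmaAlgebra_le hS.indep hT
      (Y := fun k ω => expNeg (V k ω)) (fun k => measurable_expNeg.comp (hV k))
      ((Finset.range n).disjSum (Finset.range n))
    simp_rw [hG, ← expNeg_sum, Finset.sum_disjSum] at h
    exact h
  have hlim : ∀ A : ℕ ⊕ ℕ → ℝ≥0∞, Tendsto (fun n => expNeg ((∑ j ∈ Finset.range n, A (.inl j)) +
      ∑ j ∈ Finset.range n, A (.inr j))) atTop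
      (𝓝 (expNeg ((∑' j, A (.inl j)) + ∑' j, A (.inr j)))) := fun A =>
    (continuous_expNeg.tendsto _).comp ((ENNReal.tendsto_nat_tsum _).add
      (ENNReal.tendsto_nat_tsum _))
  refine tendsto_nhds_unique ?_ (hlim G)
  simp_rw [← hfin]
  refine tendsto_lintegral_of_dominated_convergence (fun _ => 1) (fun n => ?_)
    (fun n => .of_forall fun ω => expNeg_le_one _) (by simp)
    (.of_forall fun ω => hlim fun k => V k ω)
  exact measurable_expNeg.comp ((Finset.measurable_sum _ fun j _ => hVm (.inl j)).add
    (Finset.measurable_sum _ fun j _ => hVm (.inr j)))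

end Network.IsModel

end

/-! ### Test functions -/

section

/-- The path loss of `y` relative to the path loss of a point at distance `r`, times `κ`. -/
def relLoss (κ : ℝ≥0∞) (α r : ℝ) (y : Plane) : ℝ≥0∞ :=
  κ * ENNReal.ofReal r ^ α * pathLoss α y

/-- The function that is infinite at the points `y` with `R * ‖y‖ < r` and zero elsewhere, so that
`exp (-∑ exclusion R r)` is the indicator of the absence of such points. -/
def exclusion (R r : ℝ) (y : Plane) : ℝ≥0∞ := if R * ‖y‖ < r then ∞ else 0

/-- Minus the logarithm of the Laplace transform of the interference caused by a station at `y`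
that is active with probability `p`. -/
def lossExponent (p κ : ℝ≥0∞) (α r : ℝ) (y : Plane) : ℝ≥0∞ :=
  negLog (thinnedLaplace p (relLoss κ α r y))

@[fun_prop]
lemma measurable_pathLoss (α : ℝ) : Measurable (pathLoss α) := by
  unfold pathLoss
  exact (ENNReal.continuous_rpow_const.measurable).comp measurable_enorm

lemma measurable_relLoss (κ : ℝ≥0∞) (α : ℝ) : Measurable (Function.uncurry (relLoss κ α)) := by
  refine (measurable_const.mul ?_).mul ((measurable_pathLoss α).comp measurable_snd)
  exact ENNReal.continuous_rpow_const.measurable.comp measurable_fst.ennreal_ofReal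

lemma relLoss_mono (κ : ℝ≥0∞) {α : ℝ} (hα : 0 ≤ α) (y : Plane) :
    Monotone fun r => relLoss κ α r y := by
  intro r r' h
  exact mul_le_mul_left (mul_le_mul_right
    (ENNReal.rpow_le_rpow (ENNReal.ofReal_le_ofReal h) hα) κ) (pathLoss α y)

lemma continuousWithinAt_relLoss {κ : ℝ≥0∞} (hκ : κ ≠ ∞) {α : ℝ} (hα : 0 < α) (y : Plane) (r : ℝ) :
    ContinuousWithinAt (fun r => relLoss κ α r y) (Iic r) r := by
  have hy_top : y ≠ 0 → pathLoss α y ≠ ∞ := fun hy => by simp [pathLoss, hy, hα]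
  by_cases hy : y = 0
  swap
  · refine Continuous.continuousWithinAt ?_
    exact (ENNReal.continuous_mul_const (hy_top hy)).comp ((ENNReal.continuous_const_mul hκ).comp
      (ENNReal.continuous_rpow_const.comp ENNReal.continuous_ofReal))
  rcases le_or_gt r 0 with hr | hr
  · have h0 : ∀ r' ≤ r, relLoss κ α r' y = 0 := fun r' h => by
      simp [relLoss, ENNReal.ofReal_of_nonpos (h.trans hr), hα]
    exact continuousWithinAt_const.congr (fun r' h => h0 r' h) (h0 r le_rfl)
  · have h0 : ∀ r' > 0, relLoss κ α r' y = κ * ∞ := fun r' h => by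
      rw [relLoss, mul_assoc]
      congr 1
      have : pathLoss α y = ∞ := by simp [pathLoss, hy, hα]
      rw [this, ENNReal.mul_top]
      simp [ENNReal.rpow_eq_zero_iff, h]
    refine ContinuousAt.continuousWithinAt ?_
    refine continuousAt_const.congr (f := fun _ => κ * ∞) ?_
    filter_upwards [lt_mem_nhds hr] with r' h
    exact (h0 r' h).symm

lemma measurable_exclusion (R : ℝ) : Measurable (Function.uncurry (exclusion R)) := by
  refine Measurable.ite (measurableSet_lt ?_ measurable_fst) measurable_const measurable_const
  exact measurable_const.mul measurable_snd.norm

lemma exclusion_mono (R : ℝ) (y : Plane) : Monotone fun r => exclusion R r y := by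
  intro r r' h
  simp only [exclusion]
  split_ifs with h1 h2
  · exact le_rfl
  · exact absurd (h1.trans_le h) h2
  · exact zero_le
  · exact le_rfl

lemma continuousWithinAt_exclusion (R : ℝ) (y : Plane) (r : ℝ) :
    ContinuousWithinAt (fun r => exclusion R r y) (Iic r) r := by
  by_cases h : R * ‖y‖ < r
  · refine ContinuousAt.continuousWithinAt ?_
    refine continuousAt_const.congr (f := fun _ => ∞) ?_
    filter_upwards [lt_mem_nhds h] with r' h'
    simp [exclusion, h']
  · have h0 : ∀ r' ≤ r, exclusion R r' y = 0 := fun r' h' => by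
      simp [exclusion, not_lt.2 (h'.trans (not_lt.1 h))]
    exact continuousWithinAt_const.congr (fun r' h => h0 r' h) (h0 r le_rfl)

lemma measurable_lossExponent {p : ℝ≥0∞} (hp : p ≤ 1) (κ : ℝ≥0∞) (α : ℝ) :
    Measurable (Function.uncurry (lossExponent p κ α)) :=
  continuous_negLog.measurable.comp
    ((continuous_thinnedLaplace hp).measurable.comp (measurable_relLoss κ α))

lemma lossExponent_mono (p κ : ℝ≥0∞) {α : ℝ} (hα : 0 ≤ α) (y : Plane) :
    Monotone fun r => lossExponent p κ α r y := fun _ _ h =>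
  negLog_antitone (thinnedLaplace_antitone p (relLoss_mono κ hα y h))

lemma continuousWithinAt_lossExponent {p κ : ℝ≥0∞} (hp : p ≤ 1) (hκ : κ ≠ ∞) {α : ℝ} (hα : 0 < α)
    (y : Plane) (r : ℝ) : ContinuousWithinAt (fun r => lossExponent p κ α r y) (Iic r) r :=
  (continuous_negLog.comp (continuous_thinnedLaplace hp)).continuousAt.comp_continuousWithinAt
    (continuousWithinAt_relLoss hκ hα y r)

lemma expNeg_lossExponent {p : ℝ≥0∞} (hp : p ≤ 1) (κ : ℝ≥0∞) (α r : ℝ) (y : Plane) :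
    expNeg (lossExponent p κ α r y) = thinnedLaplace p (relLoss κ α r y) :=
  expNeg_negLog (thinnedLaplace_le_one hp _)

/-! ### The closest point of a configuration -/

/-- The `i`-th point of the configuration `x` is at most `R` times as far from the origin as any
other point. -/
def IsCenter (R : ℝ) (x : ℕ → Plane) (i : ℕ) : Prop := ∀ j ≠ i, ‖x i‖ ≤ R * ‖x j‖

lemma expNeg_sumOthers_exclusion (R : ℝ) (x : ℕ → Plane) (i : ℕ) :
    expNeg (sumOthers (exclusion R ‖x i‖) x i) = {x | IsCenter R x i}.indicator 1 x := by
  by_cases h : IsCenter R x i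
  · rw [indicator_of_mem (by exact h)]
    have : sumOthers (exclusion R ‖x i‖) x i = 0 := by
      refine ENNReal.tsum_eq_zero.2 fun j => ?_
      split_ifs with hj
      · rfl
      · simp [exclusion, not_lt.2 (h j hj)]
    simp [this]
  · rw [indicator_of_notMem (by exact h)]
    rw [IsCenter] at h
    push Not at h
    obtain ⟨j, hj, hlt⟩ := h
    have : sumOthers (exclusion R ‖x i‖) x i = ∞ := by
      refine ENNReal.tsum_eq_top_of_eq_top ⟨j, ?_⟩
      simp [exclusion, hj, hlt]
    simp [this]

lemma measurableSet_isCenter (R : ℝ) (i : ℕ) : MeasurableSet {x : ℕ → Plane | IsCenter R x i} := by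
  have : {x : ℕ → Plane | IsCenter R x i} = ⋂ j, {x | j ≠ i → ‖x i‖ ≤ R * ‖x j‖} := by
    ext x; simp [IsCenter]
  rw [this]
  refine MeasurableSet.iInter fun j => ?_
  by_cases hj : j = i
  · simp [hj]
  · simp only [ne_eq, hj, not_false_eq_true, forall_const]
    exact measurableSet_le (measurable_pi_apply i).norm
      (measurable_const.mul (measurable_pi_apply j).norm)

lemma exists_norm_le_of_finite {x : ℕ → Plane} (hx : ∀ r : ℝ, {j | ‖x j‖ ≤ r}.Finite)
    {s : Set ℕ} (hs : s.Nonempty) : ∃ i ∈ s, ∀ j ∈ s, ‖x i‖ ≤ ‖x j‖ := by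
  obtain ⟨a, ha⟩ := hs
  obtain ⟨i, hi, hmin⟩ := Set.exists_min_image (s ∩ {j | ‖x j‖ ≤ ‖x a‖}) (fun j => ‖x j‖)
    ((hx _).subset inter_subset_right) ⟨a, ha, le_refl ‖x a‖⟩
  refine ⟨i, hi.1, fun j hj => ?_⟩
  by_cases h : ‖x j‖ ≤ ‖x a‖
  · exact hmin j ⟨hj, h⟩
  · exact hi.2.trans (not_le.1 h).le

section Geometry

variable {Ω : Type*} {X : ℕ → Ω → Plane} {ω : Ω} {i : ℕ}

lemma kthDist_one (hi : ∀ j, ‖X i ω‖ ≤ ‖X j ω‖) : kthDist X 1 ω = ‖X i ω‖ := by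
  have : {r : ℝ | ((1 : ℕ) : ℕ∞) ≤ pointCount X (Metric.closedBall 0 r) ω} = Ici ‖X i ω‖ := by
    ext r
    simp only [mem_ofPred_eq, mem_Ici, pointCount, Nat.cast_one, one_le_encard_iff_nonempty]
    constructor
    · rintro ⟨j, hj⟩
      exact (hi j).trans (by simpa using hj)
    · exact fun h => ⟨i, by simpa using h⟩
  rw [kthDist, this, csInf_Ici]

lemma kthDist_two {k : ℕ} (hik : k ≠ i) (hi : ∀ j, ‖X i ω‖ ≤ ‖X j ω‖)
    (hk : ∀ j ≠ i, ‖X k ω‖ ≤ ‖X j ω‖) : kthDist X 2 ω = ‖X k ω‖ := by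
  have : {r : ℝ | ((2 : ℕ) : ℕ∞) ≤ pointCount X (Metric.closedBall 0 r) ω} = Ici ‖X k ω‖ := by
    ext r
    have h2 : ((2 : ℕ) : ℕ∞) = 1 + 1 := by norm_num
    rw [mem_ofPred_eq, h2, ENat.add_one_le_iff (by simp), pointCount, one_lt_encard_iff, mem_Ici]
    simp only [mem_ofPred_eq, mem_closedBall_zero_iff]
    constructor
    · rintro ⟨a, b, ha, hb, hab⟩
      by_cases h : a = i
      · exact (hk b fun h' => hab (h.trans h'.symm)).trans hb
      · exact (hk a h).trans ha
    · exact fun h => ⟨k, i, h, (hi k).trans h, hik⟩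
  rw [kthDist, this, csInf_Ici]

lemma kthDist_div_le_iff {R : ℝ} (hR : 0 ≤ R) (hfin : ∀ r : ℝ, {j | ‖X j ω‖ ≤ r}.Finite)
    (h0 : ∀ j, X j ω ≠ 0) (hi : ∀ j, ‖X i ω‖ ≤ ‖X j ω‖) :
    kthDist X 1 ω / kthDist X 2 ω ≤ R ↔ IsCenter R (fun j => X j ω) i := by
  obtain ⟨k, hki, hk⟩ := exists_norm_le_of_finite (x := fun j => X j ω) hfin
    (s := {j | j ≠ i}) ⟨i + 1, by simp⟩
  rw [kthDist_one hi, kthDist_two hki hi hk, div_le_iff₀ (norm_pos_iff.2 (h0 k))]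
  exact ⟨fun h j hj => h.trans (mul_le_mul_of_nonneg_left (hk j hj) hR), fun h => h k hki⟩

lemma serving_eq {S : Network Ω} {α PB : ℝ} (hα : 0 < α) (hPB : 0 < PB)
    (hi : ∀ j ≠ i, ‖S.macroPos i ω‖ < ‖S.macroPos j ω‖) : S.serving α PB ω = i := by
  have hle : ∀ j k, ENNReal.ofReal PB * pathLoss α (S.macroPos j ω) ≤
      ENNReal.ofReal PB * pathLoss α (S.macroPos k ω) ↔
      ‖S.macroPos k ω‖ ≤ ‖S.macroPos j ω‖ := by
    intro j k
    rw [ENNReal.mul_le_mul_iff_right (by simpa using hPB) ENNReal.ofReal_ne_top, pathLoss, pathLoss,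
      ENNReal.rpow_neg, ENNReal.rpow_neg, ENNReal.inv_le_inv, ENNReal.rpow_le_rpow_iff hα,
      ← ofReal_norm, ← ofReal_norm, ENNReal.ofReal_le_ofReal_iff (norm_nonneg _)]
  have : {i : ℕ | ∀ j, ENNReal.ofReal PB * pathLoss α (S.macroPos j ω) ≤
      ENNReal.ofReal PB * pathLoss α (S.macroPos i ω)} = {i} := by
    ext k
    simp only [hle, mem_ofPred_eq, mem_singleton_iff]
    constructor
    · intro h
      by_contra hk
      exact absurd (h i) (not_le.2 (hi k hk))
    · rintro rfl j
      by_cases hj : j = k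
      · rw [hj]
      · exact (hi j hj).le
  rw [Network.serving, this, csInf_singleton]

end Geometry

namespace IsPoissonProcess

variable {Ω : Type*} [MeasurableSpace Ω] {μ : Measure Ω} {lam : ℝ} {X : ℕ → Ω → Plane}
variable [IsProbabilityMeasure μ]

lemma ae_finite_norm_le (hX : IsPoissonProcess μ lam X) (hlam : 0 ≤ lam) :
    ∀ᵐ ω ∂μ, ∀ r : ℝ, {j | ‖X j ω‖ ≤ r}.Finite := by
  have h : ∀ᵐ ω ∂μ, ∀ n : ℕ, pointCount X (Metric.closedBall 0 n) ω ≠ ⊤ :=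
    ae_all_iff.2 fun n => hX.ae_pointCount_ne_top hlam measurableSet_closedBall
      measure_closedBall_lt_top.ne
  filter_upwards [h] with ω hω r
  have := Set.encard_ne_top_iff.1 (hω ⌈r⌉₊)
  refine this.subset fun j hj => ?_
  simpa using le_trans hj (Nat.le_ceil r)

lemma ae_ne_zero (hX : IsPoissonProcess μ lam X) (hlam : 0 ≤ lam) :
    ∀ᵐ ω ∂μ, ∀ j, X j ω ≠ 0 := by
  have hm := measurable_toENNReal_pointCount hX.measurable (measurableSet_singleton (0 : Plane))
  have h := hX.lintegral_pointCount hlam (measurableSet_singleton (0 : Plane)) (by simp)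
  rw [measure_singleton, mul_zero, lintegral_eq_zero_iff hm] at h
  filter_upwards [h] with ω hω j hj
  simp only [Pi.zero_apply, ENat.toENNReal_eq_zero, pointCount, encard_eq_zero] at hω
  exact (Set.eq_empty_iff_forall_notMem.1 hω j) (by simpa using hj)

end IsPoissonProcess

end

/-! ### Radial integrals -/

section

lemma volume_norm_sq_le (b : ℝ) :
    volume {y : Plane | ‖y‖ ^ 2 ≤ b} = ENNReal.ofReal Real.pi * ENNReal.ofReal b := by
  rcases lt_or_ge b 0 with hb | hb
  · have : {y : Plane | ‖y‖ ^ 2 ≤ b} = ∅ :=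
      eq_empty_iff_forall_notMem.2 fun y hy => absurd (hy.trans_lt hb) (not_lt.2 (sq_nonneg _))
    rw [this, ENNReal.ofReal_of_nonpos hb.le]; simp
  · have : {y : Plane | ‖y‖ ^ 2 ≤ b} = Metric.closedBall 0 (Real.sqrt b) := by
      ext y; simp [Real.le_sqrt (norm_nonneg y) hb]
    rw [this, EuclideanSpace.volume_closedBall_fin_two, ← ENNReal.ofReal_pow (Real.sqrt_nonneg b),
      Real.sq_sqrt hb, mul_comm]

lemma map_norm_sq_volume :
    (volume : Measure Plane).map (fun y => ‖y‖ ^ 2) =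
      Real.toNNReal Real.pi • volume.restrict (Ioi (0 : ℝ)) := by
  have hm : Measurable fun y : Plane => ‖y‖ ^ 2 := measurable_norm.pow_const 2
  have hIic : ∀ b, ((volume : Measure Plane).map fun y => ‖y‖ ^ 2) (Iic b) =
      (Real.toNNReal Real.pi • volume.restrict (Ioi (0 : ℝ))) (Iic b) := by
    intro b
    rw [Measure.map_apply hm measurableSet_Iic, Measure.smul_apply,
      Measure.restrict_apply measurableSet_Iic, inter_comm, Ioi_inter_Iic, Real.volume_Ioc,
      sub_zero]
    exact volume_norm_sq_le b
  refine (Measure.ext_of_Ioc _ _ fun a b hab => ?_).symm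
  have hfin : (Real.toNNReal Real.pi • volume.restrict (Ioi (0 : ℝ))) (Iic a) ≠ ∞ := by
    rw [← hIic, Measure.map_apply hm measurableSet_Iic]
    have := volume_norm_sq_le a
    exact ne_of_eq_of_ne this (ENNReal.mul_ne_top ENNReal.ofReal_ne_top ENNReal.ofReal_ne_top)
  rw [← Iic_sdiff_Iic, measure_sdiff (Iic_subset_Iic.2 hab.le) nullMeasurableSet_Iic hfin,
    measure_sdiff (Iic_subset_Iic.2 hab.le) nullMeasurableSet_Iic (by rwa [hIic]), hIic, hIic]

/-- Integration in polar coordinates, in terms of the squared norm. -/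
lemma lintegral_norm_sq {g : ℝ → ℝ≥0∞} (hg : Measurable g) :
    ∫⁻ y : Plane, g (‖y‖ ^ 2) = ENNReal.ofReal Real.pi * ∫⁻ u in Ioi (0 : ℝ), g u := by
  rw [← lintegral_map hg (measurable_norm.pow_const 2), map_norm_sq_volume, lintegral_smul_measure]
  rfl

lemma lintegral_exp_neg_mul_norm_sq {K : ℝ} (hK : 0 < K) :
    ∫⁻ y : Plane, ENNReal.ofReal (Real.exp (-(K * ‖y‖ ^ 2))) = ENNReal.ofReal (Real.pi / K) := by
  rw [lintegral_norm_sq (g := fun u => ENNReal.ofReal (Real.exp (-(K * u)))) (by fun_prop)]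
  have hint := exp_neg_integrableOn_Ioi 0 hK
  simp_rw [← neg_mul]
  rw [← ofReal_integral_eq_lintegral_ofReal hint (.of_forall fun u => (Real.exp_pos _).le),
    integral_exp_mul_Ioi (by linarith), ← ENNReal.ofReal_mul Real.pi_pos.le]
  congr 1
  simp
  ring

/-! ### The integral of `1 / (1 + v ^ p)` -/

lemma lintegral_one_div_one_add_rpow {p : ℝ} (hp : 1 < p) :
    ∫⁻ v in Ioi (0 : ℝ), ENNReal.ofReal (1 / (1 + v ^ p)) =
      ENNReal.ofReal (Real.pi * (1 / p) * (1 / Real.sin (Real.pi * (1 / p)))) := by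
  have hp0 : 0 < p := by linarith
  have hp1 : 1 / p < 1 := by rw [div_lt_one hp0]; exact hp
  -- write the integrand as `∫ exp (-t (1 + v ^ p)) dt` and integrate over `v` before `t`
  have h1 : ∀ v ∈ Ioi (0 : ℝ), ENNReal.ofReal (1 / (1 + v ^ p)) =
      ∫⁻ t in Ioi (0 : ℝ), ENNReal.ofReal (Real.exp (-t) * Real.exp (-t * v ^ p)) := by
    intro v hv
    have hb : 0 < 1 + v ^ p := by have := Real.rpow_pos_of_pos hv p; linarith
    have := integral_exp_mul_Ioi (a := -(1 + v ^ p)) (by linarith) 0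
    rw [mul_zero, Real.exp_zero, neg_div_neg_eq] at this
    rw [← this, ofReal_integral_eq_lintegral_ofReal (exp_neg_integrableOn_Ioi 0 hb)
      (.of_forall fun u => (Real.exp_pos _).le)]
    refine lintegral_congr fun t => ?_
    rw [← Real.exp_add]
    congr 2; ring
  have h2 : ∀ t ∈ Ioi (0 : ℝ),
      ∫⁻ v in Ioi (0 : ℝ), ENNReal.ofReal (Real.exp (-t) * Real.exp (-t * v ^ p)) =
      ENNReal.ofReal (Real.Gamma (1 / p + 1)) *
        ENNReal.ofReal (Real.exp (-t) * t ^ ((1 - 1 / p) - 1)) := by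
    intro t ht
    have hint : IntegrableOn (fun v : ℝ => Real.exp (-t * v ^ p)) (Ioi 0) := by
      simpa using integrableOn_rpow_mul_exp_neg_mul_rpow (s := 0) (by norm_num) hp0 ht
    simp_rw [ENNReal.ofReal_mul (Real.exp_pos (-t)).le]
    rw [lintegral_const_mul _ (by fun_prop), ← ofReal_integral_eq_lintegral_ofReal hint
      (.of_forall fun u => (Real.exp_pos _).le), integral_exp_neg_mul_rpow hp0 ht,
      ENNReal.ofReal_mul (Real.rpow_nonneg (le_of_lt ht) _)]
    rw [show 1 - 1 / p - 1 = -1 / p by ring]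
    ring
  rw [setLIntegral_congr_fun measurableSet_Ioi h1, lintegral_lintegral_swap,
    setLIntegral_congr_fun measurableSet_Ioi h2, lintegral_const_mul _ (by fun_prop),
    ← ofReal_integral_eq_lintegral_ofReal (Real.GammaIntegral_convergent (by linarith)),
    ← Real.Gamma_eq_integral (by linarith), ← ENNReal.ofReal_mul, Real.Gamma_add_one, mul_assoc,
    Real.Gamma_mul_Gamma_one_sub]
  · congr 1; ring
  · positivity
  · exact (Real.Gamma_pos_of_pos (by positivity)).le
  · filter_upwards [ae_restrict_mem measurableSet_Ioi] with t ht
    have := Real.rpow_nonneg (le_of_lt ht) (1 - 1 / p - 1)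
    positivity
  · fun_prop

lemma integrableOn_one_div_one_add_rpow {p : ℝ} (hp : 1 < p) {a : ℝ} (ha : 0 ≤ a) :
    IntegrableOn (fun v : ℝ => 1 / (1 + v ^ p)) (Ioi a) := by
  refine IntegrableOn.mono_set (t := Ioi 0) ⟨?_, ?_⟩ (Ioi_subset_Ioi ha)
  · exact (Measurable.aestronglyMeasurable (by fun_prop))
  rw [hasFiniteIntegral_iff_ofReal, lintegral_one_div_one_add_rpow hp]
  · exact ENNReal.ofReal_lt_top
  · filter_upwards [ae_restrict_mem measurableSet_Ioi] with v hv
    have := Real.rpow_nonneg (le_of_lt hv) p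
    simp only [Pi.zero_apply]
    positivity

lemma ofReal_integral_one_div_one_add_rpow {p : ℝ} (hp : 1 < p) {a : ℝ} (ha : 0 ≤ a) :
    ENNReal.ofReal (∫ v in Ioi a, 1 / (1 + v ^ p)) =
      ∫⁻ v in Ioi a, ENNReal.ofReal (1 / (1 + v ^ p)) := by
  refine ofReal_integral_eq_lintegral_ofReal (integrableOn_one_div_one_add_rpow hp ha) ?_
  filter_upwards [ae_restrict_mem measurableSet_Ioi] with v hv
  have := Real.rpow_nonneg (ha.trans (le_of_lt hv)) p
  simp only [Pi.zero_apply]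
  positivity

lemma lintegral_Ioi_comp_div {g : ℝ → ℝ≥0∞} (hg : Measurable g) {b : ℝ} (hb : 0 < b) (A : ℝ) :
    ∫⁻ u in Ioi A, g (u / b) = ENNReal.ofReal b * ∫⁻ v in Ioi (A / b), g v := by
  have h := Real.map_volume_mul_right (inv_ne_zero hb.ne')
  rw [inv_inv, abs_of_pos hb] at h
  have hi : Measurable ((Ioi (A / b)).indicator g) := hg.indicator measurableSet_Ioi
  rw [← lintegral_indicator measurableSet_Ioi, ← lintegral_indicator measurableSet_Ioi,
    ← smul_eq_mul, ← lintegral_smul_measure, ← h, lintegral_map hi (measurable_mul_const _)]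
  refine lintegral_congr fun u => ?_
  simp only [indicator, mem_Ioi, ← div_eq_mul_inv, div_lt_div_iff_of_pos_right hb]

end

/-! ### Interference of a Poisson field of stations -/

section

lemma one_sub_inv_one_add_relLoss {κ α r : ℝ} (hκ : 0 < κ) (hα : 0 < α) (hr : 0 < r) {y : Plane}
    (hy : y ≠ 0) :
    1 - (1 + relLoss (ENNReal.ofReal κ) α r y)⁻¹ =
      ENNReal.ofReal (1 / (1 + (‖y‖ ^ 2 / (r ^ 2 * κ ^ (2 / α))) ^ (1 / (2 / α)))) := by
  have hy' : 0 < ‖y‖ := norm_pos_iff.2 hy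
  set c : ℝ := κ * r ^ α * ‖y‖ ^ (-α) with hc
  have hc0 : 0 < c := by positivity
  have h1 : relLoss (ENNReal.ofReal κ) α r y = ENNReal.ofReal c := by
    rw [relLoss, pathLoss, ← ofReal_norm, ENNReal.ofReal_rpow_of_pos hr,
      ENNReal.ofReal_rpow_of_pos hy', ← ENNReal.ofReal_mul hκ.le,
      ← ENNReal.ofReal_mul (by positivity)]
  have h2 : (‖y‖ ^ 2 / (r ^ 2 * κ ^ (2 / α))) ^ (1 / (2 / α)) = c⁻¹ := by
    have hsq : ∀ t : ℝ, 0 < t → (t ^ 2) ^ (1 / (2 / α)) = t ^ α := by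
      intro t ht
      rw [← Real.rpow_natCast, ← Real.rpow_mul ht.le]
      congr 1; push_cast; field_simp
    rw [Real.div_rpow (by positivity) (by positivity),
      Real.mul_rpow (by positivity) (by positivity),
      hsq _ hy', hsq _ hr, ← Real.rpow_mul hκ.le, show 2 / α * (1 / (2 / α)) = 1 by field_simp,
      Real.rpow_one, hc, Real.rpow_neg hy'.le]
    field_simp
  rw [h1, h2, ← ENNReal.ofReal_one, ← ENNReal.ofReal_add zero_le_one hc0.le,
    ← ENNReal.ofReal_inv_of_pos (by positivity), ← ENNReal.ofReal_sub _ (by positivity)]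
  congr 1
  field_simp
  ring

lemma H_nonneg {β δ R : ℝ} (hβ : 0 < β) (hR : 0 < R) : 0 ≤ H β δ R := by
  refine mul_nonneg (by positivity) (setIntegral_nonneg measurableSet_Ioi fun v hv => ?_)
  have : 0 ≤ v := le_trans (by positivity) (le_of_lt hv)
  positivity

lemma sin_pi_mul_two_div_pos {α : ℝ} (hα : 2 < α) : 0 < Real.sin (Real.pi * (2 / α)) := by
  have h2 : 2 / α < 1 := by rw [div_lt_one (by linarith)]; exact hα
  have h1 : 0 < 2 / α := by positivity
  exact Real.sin_pos_of_pos_of_lt_pi (by positivity) (by nlinarith [Real.pi_pos])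

lemma measurable_ofReal_one_div_one_add_rpow (p : ℝ) :
    Measurable fun v : ℝ => ENNReal.ofReal (1 / (1 + v ^ p)) := by fun_prop

lemma lintegral_one_sub_expNeg_lossExponent {p κ α r : ℝ} (hp1 : p ≤ 1)
    (hκ : 0 < κ) (hα : 2 < α) (hr : 0 < r) :
    ∫⁻ y, (1 - expNeg (lossExponent (ENNReal.ofReal p) (ENNReal.ofReal κ) α r y)) =
      ENNReal.ofReal (p * Real.pi * (2 / α) * κ ^ (2 / α) *
        (Real.pi * (1 / Real.sin (Real.pi * (2 / α)))) * r ^ 2) := by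
  have hp1' : ENNReal.ofReal p ≤ 1 := ENNReal.ofReal_le_one.2 hp1
  have hb : 0 < r ^ 2 * κ ^ (2 / α) := by positivity
  have hδ : 1 < 1 / (2 / α) := by rw [one_div_div]; linarith
  have hsin := sin_pi_mul_two_div_pos hα
  have h1 : ∀ᵐ y : Plane,
      1 - expNeg (lossExponent (ENNReal.ofReal p) (ENNReal.ofReal κ) α r y) =
      ENNReal.ofReal p * ENNReal.ofReal
        (1 / (1 + (‖y‖ ^ 2 / (r ^ 2 * κ ^ (2 / α))) ^ (1 / (2 / α)))) := by
    have : ∀ᵐ y : Plane, y ≠ 0 := by simp [ae_iff]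
    filter_upwards [this] with y hy
    rw [expNeg_lossExponent hp1', one_sub_thinnedLaplace hp1',
      one_sub_inv_one_add_relLoss hκ (by linarith) hr hy]
  have hg := measurable_ofReal_one_div_one_add_rpow (1 / (2 / α))
  have hg' : Measurable fun u : ℝ =>
      ENNReal.ofReal (1 / (1 + (u / (r ^ 2 * κ ^ (2 / α))) ^ (1 / (2 / α)))) :=
    hg.comp (measurable_id.div_const _)
  rw [lintegral_congr_ae h1, lintegral_const_mul]
  swap
  · exact hg'.comp (measurable_norm.pow_const 2)
  rw [lintegral_norm_sq hg', lintegral_Ioi_comp_div hg hb 0, zero_div,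
    lintegral_one_div_one_add_rpow hδ, one_div_one_div, ← ENNReal.ofReal_mul hb.le,
    ← ENNReal.ofReal_mul Real.pi_pos.le, ← ENNReal.ofReal_mul' (by positivity)]
  congr 1
  field_simp

lemma lintegral_one_sub_expNeg_exclusion_add_lossExponent {p κ α r R : ℝ} (hp0 : 0 ≤ p)
    (hp1 : p ≤ 1) (hκ : 0 < κ) (hα : 2 < α) (hr : 0 < r) (hR : 0 < R) :
    ∫⁻ y, (1 - expNeg (exclusion R r y +
        lossExponent (ENNReal.ofReal p) (ENNReal.ofReal κ) α r y)) =
      ENNReal.ofReal (Real.pi * ((R ^ 2)⁻¹ + p * H κ (2 / α) R) * r ^ 2) := by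
  have hp1' : ENNReal.ofReal p ≤ 1 := ENNReal.ofReal_le_one.2 hp1
  have hb : 0 < r ^ 2 * κ ^ (2 / α) := by positivity
  have hδ : 1 < 1 / (2 / α) := by rw [one_div_div]; linarith
  set A : ℝ := r ^ 2 / R ^ 2 with hA
  have hA0 : 0 < A := by positivity
  have hAb : A / (r ^ 2 * κ ^ (2 / α)) = R ^ (-2 : ℝ) * κ ^ (-(2 / α)) := by
    rw [hA, Real.rpow_neg hR.le, Real.rpow_neg hκ.le, Real.rpow_two]
    field_simp
  let g : ℝ → ℝ≥0∞ := fun v => ENNReal.ofReal (1 / (1 + v ^ (1 / (2 / α))))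
  have hg : Measurable g := measurable_ofReal_one_div_one_add_rpow _
  have hg' : Measurable fun u => g (u / (r ^ 2 * κ ^ (2 / α))) :=
    hg.comp (measurable_id.div_const _)
  let G : ℝ → ℝ≥0∞ := fun u => (Iio A).indicator 1 u +
    ENNReal.ofReal p * (Ici A).indicator (fun u => g (u / (r ^ 2 * κ ^ (2 / α)))) u
  have hG1 : Measurable ((Iio A).indicator (1 : ℝ → ℝ≥0∞)) :=
    measurable_one.indicator measurableSet_Iio
  have hG2 : Measurable ((Ici A).indicator (fun u => g (u / (r ^ 2 * κ ^ (2 / α))))) :=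
    hg'.indicator measurableSet_Ici
  have h1 : ∀ᵐ y : Plane, 1 - expNeg (exclusion R r y +
      lossExponent (ENNReal.ofReal p) (ENNReal.ofReal κ) α r y) = G (‖y‖ ^ 2) := by
    have : ∀ᵐ y : Plane, y ≠ 0 := by simp [ae_iff]
    filter_upwards [this] with y hy
    have hiff : R * ‖y‖ < r ↔ ‖y‖ ^ 2 < A := by
      rw [hA, lt_div_iff₀ (by positivity), ← mul_pow, mul_comm,
        pow_lt_pow_iff_left₀ (by positivity) hr.le two_ne_zero]
    by_cases h : R * ‖y‖ < r
    · have h' := hiff.1 h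
      simp [exclusion, h, G, indicator, h', not_le.2 h']
    · have h' : ¬ ‖y‖ ^ 2 < A := fun h' => h (hiff.2 h')
      rw [exclusion, if_neg h, zero_add, expNeg_lossExponent hp1', one_sub_thinnedLaplace hp1',
        one_sub_inv_one_add_relLoss hκ (by linarith) hr hy]
      simp [G, g, indicator, h', not_lt.1 h']
  have hG : Measurable G := hG1.add (hG2.const_mul _)
  rw [lintegral_congr_ae h1, lintegral_norm_sq hG, lintegral_add_left hG1,
    lintegral_const_mul _ hG2, lintegral_indicator_one measurableSet_Iio,
    lintegral_indicator measurableSet_Ici, Measure.restrict_restrict measurableSet_Ici,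
    Measure.restrict_apply measurableSet_Iio, Iio_inter_Ioi, Real.volume_Ioo, sub_zero,
    inter_eq_left.2 (show Ici A ⊆ Ioi 0 from fun u hu => hA0.trans_le hu),
    ← setLIntegral_congr Ioi_ae_eq_Ici, lintegral_Ioi_comp_div hg hb, hAb,
    ← ofReal_integral_one_div_one_add_rpow hδ (by positivity)]
  set I := ∫ v in Ioi (R ^ (-2 : ℝ) * κ ^ (-(2 / α))), 1 / (1 + v ^ (1 / (2 / α))) with hI
  have hI0 : 0 ≤ I := by
    refine setIntegral_nonneg measurableSet_Ioi fun v hv => ?_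
    have : 0 ≤ v := le_trans (by positivity) (le_of_lt hv)
    positivity
  rw [← ENNReal.ofReal_mul hb.le, ← ENNReal.ofReal_mul hp0,
    ← ENNReal.ofReal_add hA0.le (by positivity), ← ENNReal.ofReal_mul Real.pi_pos.le, H, ← hI]
  congr 1
  rw [hA]
  ring

namespace IsPoissonProcess

variable {Ω : Type*} [MeasurableSpace Ω] {μ : Measure Ω} {lam : ℝ} {X : ℕ → Ω → Plane}
variable [IsProbabilityMeasure μ]

/-- The Laplace transform of the interference of a thinned Poisson field, observed at the relative
strength determined by a useful signal from distance `r`. -/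
lemma lintegral_expNeg_tsum_lossExponent (hX : IsPoissonProcess μ lam X) (hlam : 0 ≤ lam)
    {p κ α r : ℝ} (hp0 : 0 ≤ p) (hp1 : p ≤ 1) (hκ : 0 < κ) (hα : 2 < α) (hr : 0 < r) :
    ∫⁻ ω, expNeg (∑' j, lossExponent (ENNReal.ofReal p) (ENNReal.ofReal κ) α r (X j ω)) ∂μ =
      ENNReal.ofReal (Real.exp (-(lam * p * Real.pi * (2 / α) * κ ^ (2 / α) *
        (Real.pi * (1 / Real.sin (Real.pi * (2 / α)))) * r ^ 2))) := by
  have hm := measurable_lossExponent (ENNReal.ofReal_le_one.2 hp1) (ENNReal.ofReal κ) α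
  have hsin := sin_pi_mul_two_div_pos hα
  have hm' : Measurable (lossExponent (ENNReal.ofReal p) (ENNReal.ofReal κ) α r) :=
    hm.of_uncurry_left
  rw [hX.lintegral_expNeg_tsum hlam hm',
    lintegral_one_sub_expNeg_lossExponent hp1 hκ hα hr, ← ENNReal.ofReal_mul hlam,
    expNeg_ofReal (by positivity)]
  refine congrArg (fun t => ENNReal.ofReal (Real.exp (-t))) ?_
  ring

/-- The Palm formula for the event that a point is closer to the origin by the factor `R` than all
others, weighted by the Laplace transforms of the interference from the others and, in the
exponential factor, from an independent tier. -/
lemma tsum_lintegral_exclusion_add_lossExponent (hX : IsPoissonProcess μ lam X) (hlam : 0 < lam)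
    {p κ α R k : ℝ} (hp0 : 0 ≤ p) (hp1 : p ≤ 1) (hκ : 0 < κ) (hα : 2 < α) (hR : 0 < R)
    (hk : 0 ≤ k) :
    ∑' i, ∫⁻ ω, ENNReal.ofReal (Real.exp (-(k * ‖X i ω‖ ^ 2))) *
        expNeg (sumOthers (fun y => exclusion R ‖X i ω‖ y +
          lossExponent (ENNReal.ofReal p) (ENNReal.ofReal κ) α ‖X i ω‖ y) (fun j => X j ω) i) ∂μ =
      ENNReal.ofReal (lam * Real.pi /
        (k + lam * Real.pi * ((R ^ 2)⁻¹ + p * H κ (2 / α) R))) := by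
  have hα0 : 0 < α := by linarith
  have hp1' : ENNReal.ofReal p ≤ 1 := ENNReal.ofReal_le_one.2 hp1
  have hH : 0 ≤ H κ (2 / α) R := H_nonneg hκ hR
  have hK : 0 < k + lam * Real.pi * ((R ^ 2)⁻¹ + p * H κ (2 / α) R) := by positivity
  have h := hX.tsum_lintegral_mul_expNeg_norm hlam.le (F := fun r y => exclusion R r y +
      lossExponent (ENNReal.ofReal p) (ENNReal.ofReal κ) α r y)
    ((measurable_exclusion R).add (measurable_lossExponent hp1' _ α))
    (fun y => (exclusion_mono R y).add (lossExponent_mono _ _ hα0.le y))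
    (fun y r => (continuousWithinAt_exclusion R y r).add
      (continuousWithinAt_lossExponent hp1' ENNReal.ofReal_ne_top hα0 y r))
    (u := fun x => ENNReal.ofReal (Real.exp (-(k * ‖x‖ ^ 2)))) (by fun_prop)
  rw [h]
  have h1 : ∀ᵐ x : Plane, ENNReal.ofReal (Real.exp (-(k * ‖x‖ ^ 2))) *
      expNeg (ENNReal.ofReal lam * ∫⁻ y, (1 - expNeg (exclusion R ‖x‖ y +
        lossExponent (ENNReal.ofReal p) (ENNReal.ofReal κ) α ‖x‖ y))) =
      ENNReal.ofReal (Real.exp (-((k + lam * Real.pi * ((R ^ 2)⁻¹ + p * H κ (2 / α) R)) *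
        ‖x‖ ^ 2))) := by
    have : ∀ᵐ y : Plane, y ≠ 0 := by simp [ae_iff]
    filter_upwards [this] with x hx
    rw [lintegral_one_sub_expNeg_exclusion_add_lossExponent hp0 hp1 hκ hα (norm_pos_iff.2 hx) hR,
      ← ENNReal.ofReal_mul hlam.le, expNeg_ofReal (by positivity),
      ← ENNReal.ofReal_mul (Real.exp_pos _).le, ← Real.exp_add]
    congr 2
    ring
  rw [lintegral_congr_ae h1, lintegral_exp_neg_mul_norm_sq hK, ← ENNReal.ofReal_mul hlam.le,
    mul_div_assoc]

end IsPoissonProcess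

end

/-! ### The cell-center event -/

section

variable {Ω : Type*} [MeasurableSpace Ω] {μ : Measure Ω}

namespace IsPoissonProcess

variable [IsProbabilityMeasure μ] {lam : ℝ} {X : ℕ → Ω → Plane}

lemma tsum_measure_isCenter (hX : IsPoissonProcess μ lam X) (hlam : 0 < lam) {R : ℝ}
    (hR : 0 < R) :
    ∑' i, μ {ω | IsCenter R (fun j => X j ω) i} = ENNReal.ofReal (R ^ 2) := by
  have h := hX.tsum_lintegral_exclusion_add_lossExponent hlam (p := 0) (κ := 1) (α := 3) (k := 0)
    le_rfl zero_le_one one_pos (by norm_num) hR le_rfl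
  have hloss : ∀ r y, lossExponent 0 1 3 r y = 0 := fun r y => by
    simp [lossExponent, thinnedLaplace, negLog]
  simp only [zero_mul, neg_zero, Real.exp_zero, ENNReal.ofReal_one, one_mul, ENNReal.ofReal_zero,
    hloss, add_zero, zero_add] at h
  have hR2 : lam * Real.pi / (lam * Real.pi * (R ^ 2)⁻¹) = R ^ 2 := by field_simp
  rw [← hR2, ← h]
  refine tsum_congr fun i => ?_
  have hm : Measurable fun ω j => X j ω := measurable_pi_lambda _ hX.measurable
  rw [← lintegral_indicator_one (show MeasurableSet {ω | IsCenter R (fun j => X j ω) i} from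
    hm (measurableSet_isCenter R i))]
  exact lintegral_congr fun ω => (expNeg_sumOthers_exclusion R (fun j => X j ω) i).symm

/-- Almost surely there is exactly one closest point: the expected number of closest points is
`1`, and there is always at least one. -/
lemma ae_exists_forall_norm_lt (hX : IsPoissonProcess μ lam X) (hlam : 0 < lam) :
    ∀ᵐ ω ∂μ, ∃ i, ∀ j ≠ i, ‖X i ω‖ < ‖X j ω‖ := by
  have hm : Measurable fun ω j => X j ω := measurable_pi_lambda _ hX.measurable
  have hA : ∀ i, MeasurableSet {ω | IsCenter 1 (fun j => X j ω) i} := fun i =>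
    hm (measurableSet_isCenter 1 i)
  let f : Ω → ℝ≥0∞ := fun ω => ∑' i, {ω | IsCenter 1 (fun j => X j ω) i}.indicator 1 ω
  have hf : Measurable f := Measurable.tsum fun i => measurable_one.indicator (hA i)
  have hint : ∫⁻ ω, f ω ∂μ = 1 := by
    rw [lintegral_tsum fun i => (measurable_one.indicator (hA i)).aemeasurable]
    simp_rw [lintegral_indicator_one (hA _)]
    rw [hX.tsum_measure_isCenter hlam one_pos]; simp
  have hex : ∀ᵐ ω ∂μ, ∃ i, ∀ j, ‖X i ω‖ ≤ ‖X j ω‖ := by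
    filter_upwards [hX.ae_finite_norm_le hlam.le] with ω hω
    obtain ⟨i, -, hi⟩ := exists_norm_le_of_finite (x := fun j => X j ω) hω (univ_nonempty)
    exact ⟨i, fun j => hi j (mem_univ j)⟩
  have hge : (1 : Ω → ℝ≥0∞) ≤ᵐ[μ] f := by
    filter_upwards [hex] with ω ⟨i, hi⟩
    have h1 : ω ∈ {ω | IsCenter 1 (fun j => X j ω) i} := fun j _ => by simpa using hi j
    have := ENNReal.le_tsum (f := fun i => {ω | IsCenter 1 (fun j => X j ω) i}.indicator
      (1 : Ω → ℝ≥0∞) ω) i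
    rwa [indicator_of_mem h1] at this
  have heq := ae_eq_of_ae_le_of_lintegral_le hge (by simp) hf.aemeasurable (by simp [hint])
  filter_upwards [hex, heq] with ω ⟨i, hi⟩ hω
  refine ⟨i, fun j hj => ?_⟩
  by_contra hlt
  have h1 : ω ∈ {ω | IsCenter 1 (fun j => X j ω) i} := fun k _ => by simpa using hi k
  have h2 : ω ∈ {ω | IsCenter 1 (fun j => X j ω) j} := fun k _ => by
    simpa using (not_lt.1 hlt).trans (hi k)
  have := ENNReal.sum_le_tsum (f := fun i => {ω | IsCenter 1 (fun j => X j ω) i}.indicator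
    (1 : Ω → ℝ≥0∞) ω) {i, j}
  rw [Finset.sum_pair hj.symm, indicator_of_mem h1, indicator_of_mem h2] at this
  change _ ≤ f ω at this
  rw [← hω] at this
  norm_num at this

end IsPoissonProcess

/-! ### The coverage event -/

lemma relLoss_mul_pathLoss (κ : ℝ≥0∞) {α : ℝ} (hα : 0 < α) {x : Plane} (hx : x ≠ 0) (y : Plane) :
    relLoss κ α ‖x‖ y * pathLoss α x = κ * pathLoss α y := by
  have h : ENNReal.ofReal ‖x‖ ^ α * pathLoss α x = 1 := by
    rw [pathLoss, ofReal_norm, ENNReal.rpow_neg, ENNReal.mul_inv_cancel]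
    · simp [hx]
    · simp [hα.le]
  rw [relLoss, mul_right_comm, mul_assoc κ, h, mul_one]

/-- The interference at the user from all stations except the `i`-th macro station, divided by the
path loss of that station, where the contributions of the two tiers are weighted by `κ` and `κ'`.
The positions `x` and the marks `m` (fading coefficients and activities) of the stations are
separate arguments, so that one can be integrated out for a fixed value of the other. -/
def relInterference (κ κ' : ℝ≥0∞) (α : ℝ) (i : ℕ) (x : (ℕ → Plane) × (ℕ → Plane))
    (m : ((ℕ → ℝ) × (ℕ → ℝ)) × ((ℕ → Bool) × (ℕ → Bool))) : ℝ≥0∞ :=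
  (∑' j, if j ≠ i ∧ m.2.1 j = true then
      ENNReal.ofReal (m.1.1 j) * relLoss κ α ‖x.1 i‖ (x.1 j) else 0) +
    ∑' j, if m.2.2 j = true then ENNReal.ofReal (m.1.2 j) * relLoss κ' α ‖x.1 i‖ (x.2 j) else 0

/-- The positions of the stations of the two tiers. -/
def Network.positions {Ω : Type*} (S : Network Ω) (ω : Ω) : (ℕ → Plane) × (ℕ → Plane) :=
  (fun j => S.macroPos j ω, fun j => S.femtoPos j ω)

/-- The fading coefficients and the activities of the stations of the two tiers. -/
def Network.marks {Ω : Type*} (S : Network Ω) (ω : Ω) :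
    ((ℕ → ℝ) × (ℕ → ℝ)) × ((ℕ → Bool) × (ℕ → Bool)) :=
  ((fun j => S.macroFading j ω, fun j => S.femtoFading j ω),
    (fun j => S.macroActive j ω, fun j => S.femtoActive j ω))

lemma Network.relInterference_positions_marks {Ω : Type*} (S : Network Ω)
    (κ κ' : ℝ≥0∞) (α : ℝ) (i : ℕ) (ω ω' : Ω) :
    relInterference κ κ' α i (S.positions ω) (S.marks ω') =
      (∑' j, if j ≠ i ∧ S.macroActive j ω' = true then ENNReal.ofReal (S.macroFading j ω') *
          relLoss κ α ‖S.macroPos i ω‖ (S.macroPos j ω) else 0) +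
        ∑' j, if S.femtoActive j ω' = true then ENNReal.ofReal (S.femtoFading j ω') *
          relLoss κ' α ‖S.macroPos i ω‖ (S.femtoPos j ω) else 0 :=
  rfl

lemma Network.lt_sir_iff {Ω : Type*} {S : Network Ω}
    {α PB PF β : ℝ} (hα : 0 < α) (hβ : 0 < β) {ω : Ω} {i : ℕ}
    (hi : S.serving α PB ω = i) (h0 : S.macroPos i ω ≠ 0) :
    ENNReal.ofReal β < S.sir α PB PF ω ↔
      relInterference (ENNReal.ofReal β) (ENNReal.ofReal (β * (PF / PB))) α i (S.positions ω)
        (S.marks ω) < ENNReal.ofReal (S.macroFading i ω) := by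
  have hl0 : pathLoss α (S.macroPos i ω) ≠ 0 := by simp [pathLoss, hα.le]
  have hl1 : pathLoss α (S.macroPos i ω) ≠ ∞ := by simp [pathLoss, h0, hα]
  have hV : relInterference (ENNReal.ofReal β) (ENNReal.ofReal (β * (PF / PB))) α i
      (S.positions ω) (S.marks ω) * pathLoss α (S.macroPos i ω) =
      ENNReal.ofReal β * (S.macroInterference α PB ω + S.femtoInterference α PB PF ω) := by
    rw [Network.relInterference_positions_marks, add_mul, mul_add,
      ← ENNReal.tsum_mul_right, ← ENNReal.tsum_mul_right,
      Network.macroInterference, Network.femtoInterference,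
      ← ENNReal.tsum_mul_left, ← ENNReal.tsum_mul_left, hi]
    congr 1
    · refine tsum_congr fun j => ?_
      split_ifs
      · rw [mul_assoc, relLoss_mul_pathLoss _ hα h0]; ring
      · simp
    · refine tsum_congr fun j => ?_
      split_ifs
      · rw [mul_assoc, relLoss_mul_pathLoss _ hα h0, ENNReal.ofReal_mul hβ.le]; ring
      · simp
  rw [Network.sir, hi, ENNReal.lt_div_iff_mul_lt (.inr ENNReal.ofReal_ne_top)
    (.inr (by simpa using hβ)), ← hV, ENNReal.mul_lt_mul_iff_left hl0 hl1]

lemma measurable_relInterference (κ κ' : ℝ≥0∞) (α : ℝ) (i : ℕ) :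
    Measurable (Function.uncurry (relInterference κ κ' α i)) := by
  refine (Measurable.tsum fun j => ?_).add (Measurable.tsum fun j => ?_)
  · refine Measurable.ite ((MeasurableSet.const _).inter ?_) (Measurable.mul (by fun_prop) ?_)
      measurable_const
    · exact measurableSet_eq_fun (by fun_prop) measurable_const
    · exact (measurable_relLoss κ α).comp (Measurable.prodMk (by fun_prop) (by fun_prop))
  · refine Measurable.ite ?_ (Measurable.mul (by fun_prop) ?_) measurable_const
    · exact measurableSet_eq_fun (by fun_prop) measurable_const
    · exact (measurable_relLoss κ' α).comp (Measurable.prodMk (by fun_prop) (by fun_prop))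

lemma lintegral_comp_prodMk_of_indepFun [IsProbabilityMeasure μ]
    {β γ : Type*} [MeasurableSpace β] [MeasurableSpace γ]
    {U : Ω → β} {V : Ω → γ} (hU : Measurable U) (hV : Measurable V) (hind : U ⟂ᵢ[μ] V)
    {Φ : β × γ → ℝ≥0∞} (hΦ : Measurable Φ) :
    ∫⁻ ω, Φ (U ω, V ω) ∂μ = ∫⁻ ω, ∫⁻ ω', Φ (U ω, V ω') ∂μ ∂μ := by
  have : IsProbabilityMeasure (μ.map V) := Measure.isProbabilityMeasure_map hV.aemeasurable
  rw [← lintegral_map hΦ (hU.prodMk hV),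
    (indepFun_iff_map_prod_eq_prod_map_map hU.aemeasurable hV.aemeasurable).1 hind,
    lintegral_prod _ hΦ.aemeasurable, lintegral_map hΦ.lintegral_prod_right' hU]
  exact lintegral_congr fun ω => lintegral_map (hΦ.comp measurable_prodMk_left) hV

namespace Network

variable {S : Network Ω}

namespace IsModel

variable {lamB lamF zeta q : ℝ}

lemma measurable_positions (hS : S.IsModel μ lamB lamF zeta q) : Measurable S.positions :=
  (measurable_pi_lambda _ hS.macro_poisson.measurable).prodMk
    (measurable_pi_lambda _ hS.femto_poisson.measurable)

lemma measurable_marks (hS : S.IsModel μ lamB lamF zeta q) : Measurable S.marks :=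
  ((measurable_pi_lambda _ hS.macro_fading_measurable).prodMk
    (measurable_pi_lambda _ hS.femto_fading_measurable)).prodMk
    ((measurable_pi_lambda _ hS.macro_active_measurable).prodMk
    (measurable_pi_lambda _ hS.femto_active_measurable))

lemma indepFun_positions_marks (hS : S.IsModel μ lamB lamF zeta q) :
    S.positions ⟂ᵢ[μ] S.marks := by
  have h := indep_iSup_of_disjoint hS.sigmaAlgebra_le hS.indep
    (S := {.macroPositions, .femtoPositions}) (T := {.macroPositions, .femtoPositions}ᶜ)
    disjoint_compl_right
  refine indep_of_indep_of_le_left (indep_of_indep_of_le_right h ?_) ?_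
  · refine Measurable.comap_le (@Measurable.prodMk _ _ _ _ _ (_) _ _
      (@Measurable.prodMk _ _ _ _ _ (_) _ _ ?_ ?_) (@Measurable.prodMk _ _ _ _ _ (_) _ _ ?_ ?_))
    · exact @measurable_pi_lambda _ _ _ (_) _ _ fun j => measurable_biSup_of_source S
        (s := .macroFading j) (by simp) (comap_measurable _)
    · exact @measurable_pi_lambda _ _ _ (_) _ _ fun j => measurable_biSup_of_source S
        (s := .femtoFading j) (by simp) (comap_measurable _)
    · exact @measurable_pi_lambda _ _ _ (_) _ _ fun j => measurable_biSup_of_source S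
        (s := .macroActivity j) (by simp) (comap_measurable _)
    · exact @measurable_pi_lambda _ _ _ (_) _ _ fun j => measurable_biSup_of_source S
        (s := .femtoActivity j) (by simp) (comap_measurable _)
  · refine Measurable.comap_le (@Measurable.prodMk _ _ _ _ _ (_) _ _ ?_ ?_)
    · exact measurable_biSup_of_source S (s := .macroPositions) (by simp) (comap_measurable _)
    · exact measurable_biSup_of_source S (s := .femtoPositions) (by simp) (comap_measurable _)

variable [IsProbabilityMeasure μ]

/-- Integrating out the marks: for given positions, the fading of the `i`-th macro station exceeds
the relative interference with a probability that is a product over the other stations. -/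
lemma measure_isCenter_inter_lt_eq_lintegral (hS : S.IsModel μ lamB lamF zeta q)
    (hzeta1 : zeta ≤ 1) (hq1 : q ≤ 1) (α κ κ' R : ℝ) (i : ℕ) :
    μ ({ω | IsCenter R (fun j => S.macroPos j ω) i} ∩
        {ω | relInterference (ENNReal.ofReal κ) (ENNReal.ofReal κ') α i (S.positions ω)
          (S.marks ω) < ENNReal.ofReal (S.macroFading i ω)}) =
      ∫⁻ ω, expNeg (sumOthers (fun y => exclusion R ‖S.macroPos i ω‖ y +
            lossExponent (ENNReal.ofReal zeta) (ENNReal.ofReal κ) α ‖S.macroPos i ω‖ y)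
            (fun j => S.macroPos j ω) i) *
          expNeg (∑' j, lossExponent (ENNReal.ofReal q) (ENNReal.ofReal κ') α ‖S.macroPos i ω‖
            (S.femtoPos j ω)) ∂μ := by
  have hP := hS.measurable_positions
  have hM := hS.measurable_marks
  let D : Set (((ℕ → Plane) × (ℕ → Plane)) × (((ℕ → ℝ) × (ℕ → ℝ)) × ((ℕ → Bool) × (ℕ → Bool)))) :=
    {p | IsCenter R p.1.1 i} ∩ {p | relInterference (ENNReal.ofReal κ) (ENNReal.ofReal κ') α i
      p.1 p.2 < ENNReal.ofReal (p.2.1.1 i)}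
  have hD : MeasurableSet D :=
    (measurable_fst.fst (measurableSet_isCenter R i)).inter
      (measurableSet_lt (measurable_relInterference _ _ α i) (by fun_prop))
  have hD1 : Measurable (D.indicator (1 : _ × _ → ℝ≥0∞)) := measurable_one.indicator hD
  have h1 : μ ((fun ω => (S.positions ω, S.marks ω)) ⁻¹' D) =
      ∫⁻ ω, D.indicator (1 : _ × _ → ℝ≥0∞) (S.positions ω, S.marks ω) ∂μ :=
    (lintegral_indicator_one (hP.prodMk hM hD)).symm
  refine h1.trans ?_
  rw [lintegral_comp_prodMk_of_indepFun hP hM hS.indepFun_positions_marks hD1]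
  refine lintegral_congr fun ω => ?_
  have h2 : ∫⁻ ω', D.indicator (1 : _ × _ → ℝ≥0∞) (S.positions ω, S.marks ω') ∂μ =
      μ ((fun ω' => (S.positions ω, S.marks ω')) ⁻¹' D) :=
    lintegral_indicator_one ((measurable_const.prodMk hM) hD)
  have hmarks := hS.measure_interference_lt_fading hzeta1 hq1 i
    (fun j => relLoss (ENNReal.ofReal κ) α ‖S.macroPos i ω‖ (S.macroPos j ω))
    (fun j => relLoss (ENNReal.ofReal κ') α ‖S.macroPos i ω‖ (S.femtoPos j ω))
  rw [h2, sumOthers_add, expNeg_add, mul_assoc, ← expNeg_add,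
    expNeg_sumOthers_exclusion R (fun j => S.macroPos j ω) i]
  by_cases hc : IsCenter R (fun j => S.macroPos j ω) i
  · rw [indicator_of_mem (by exact hc), Pi.one_apply, one_mul]
    refine Eq.trans (congrArg μ ?_) hmarks
    ext ω'
    exact and_iff_right hc
  · rw [indicator_of_notMem (by exact hc), zero_mul]
    convert! measure_empty (μ := μ)
    exact eq_empty_iff_forall_notMem.2 fun ω' h => hc h.1

/-- Integrating out the marks and the positions of the femto tier. -/
lemma measure_isCenter_inter_lt (hS : S.IsModel μ lamB lamF zeta q) (hlamB : 0 ≤ lamB)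
    (hlamF : 0 ≤ lamF) (hzeta1 : zeta ≤ 1) (hq0 : 0 ≤ q) (hq1 : q ≤ 1) {α κ κ' : ℝ} (hα : 2 < α)
    (hκ' : 0 < κ') (R : ℝ) (i : ℕ) :
    μ ({ω | IsCenter R (fun j => S.macroPos j ω) i} ∩
        {ω | relInterference (ENNReal.ofReal κ) (ENNReal.ofReal κ') α i (S.positions ω)
          (S.marks ω) < ENNReal.ofReal (S.macroFading i ω)}) =
      ∫⁻ ω, ENNReal.ofReal (Real.exp (-(lamF * q * Real.pi * (2 / α) * κ' ^ (2 / α) *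
          (Real.pi * (1 / Real.sin (Real.pi * (2 / α)))) * ‖S.macroPos i ω‖ ^ 2))) *
        expNeg (sumOthers (fun y => exclusion R ‖S.macroPos i ω‖ y +
          lossExponent (ENNReal.ofReal zeta) (ENNReal.ofReal κ) α ‖S.macroPos i ω‖ y)
          (fun j => S.macroPos j ω) i) ∂μ := by
  rw [hS.measure_isCenter_inter_lt_eq_lintegral hzeta1 hq1]
  let Φ : (ℕ → Plane) × (ℕ → Plane) → ℝ≥0∞ := fun x =>
    expNeg (sumOthers (fun y => exclusion R ‖x.1 i‖ y +
      lossExponent (ENNReal.ofReal zeta) (ENNReal.ofReal κ) α ‖x.1 i‖ y) x.1 i) *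
    expNeg (∑' j, lossExponent (ENNReal.ofReal q) (ENNReal.ofReal κ') α ‖x.1 i‖ (x.2 j))
  have hr : Measurable fun x : (ℕ → Plane) × (ℕ → Plane) => ‖x.1 i‖ := by fun_prop
  have hloss := measurable_lossExponent (ENNReal.ofReal_le_one.2 hq1) (ENNReal.ofReal κ') α
  have hF : Measurable (Function.uncurry fun r y => exclusion R r y +
      lossExponent (ENNReal.ofReal zeta) (ENNReal.ofReal κ) α r y) := (measurable_exclusion R).add
    (measurable_lossExponent (ENNReal.ofReal_le_one.2 hzeta1) (ENNReal.ofReal κ) α)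
  have hx : ∀ j, Measurable fun x : (ℕ → Plane) × (ℕ → Plane) => x.1 j := fun j => by fun_prop
  have hx' : ∀ j, Measurable fun x : (ℕ → Plane) × (ℕ → Plane) => x.2 j := fun j => by fun_prop
  have hΦ : Measurable Φ := by
    refine (measurable_expNeg.comp (measurable_sumOthers_comp hx hF hr i)).mul
      (measurable_expNeg.comp (Measurable.tsum fun j => ?_))
    simpa only [Function.comp_def, Function.uncurry_apply_pair] using
      hloss.comp (hr.prodMk (hx' j))
  have hind : (fun ω j => S.macroPos j ω) ⟂ᵢ[μ] (fun ω j => S.femtoPos j ω) :=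
    hS.indep.indep (i := .macroPositions) (j := .femtoPositions) (by simp)
  refine (lintegral_comp_prodMk_of_indepFun (Φ := Φ)
    (measurable_pi_lambda _ hS.macro_poisson.measurable)
    (measurable_pi_lambda _ hS.femto_poisson.measurable) hind hΦ).trans ?_
  refine lintegral_congr_ae ?_
  filter_upwards [hS.macro_poisson.ae_ne_zero hlamB] with ω hω
  simp only [Φ]
  rw [lintegral_const_mul' _ _ (expNeg_ne_top _),
    hS.femto_poisson.lintegral_expNeg_tsum_lossExponent hlamF hq0 hq1
    hκ' hα (norm_pos_iff.2 (hω i)), mul_comm]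

end IsModel

end Network

end

/-! ### The coverage probability -/

section

namespace Network.IsModel

variable {Ω : Type*} [MeasurableSpace Ω] {μ : Measure Ω} [IsProbabilityMeasure μ] {S : Network Ω}
  {lamB lamF zeta q : ℝ}

/-- Almost surely, the serving station is the unique closest one, it is the only station that can
be closer than all others by a factor `R ≤ 1`, and the events in question are events about it. -/
lemma ae_exists_serving (hS : S.IsModel μ lamB lamF zeta q) (hlamB : 0 < lamB)
    {α PB PF β R : ℝ} (hα : 0 < α) (hPB : 0 < PB) (hβ : 0 < β) (hR0 : 0 < R) (hR1 : R ≤ 1) :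
    ∀ᵐ ω ∂μ, ∃ i, (∀ j, IsCenter R (fun k => S.macroPos k ω) j → j = i) ∧
      (ω ∈ S.cellCenter R ↔ IsCenter R (fun k => S.macroPos k ω) i) ∧
      (ω ∈ S.covered α PB PF β ↔
        relInterference (ENNReal.ofReal β) (ENNReal.ofReal (β * (PF / PB))) α i (S.positions ω)
          (S.marks ω) < ENNReal.ofReal (S.macroFading i ω)) := by
  filter_upwards [hS.macro_poisson.ae_exists_forall_norm_lt hlamB,
    hS.macro_poisson.ae_ne_zero hlamB.le, hS.macro_poisson.ae_finite_norm_le hlamB.le]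
    with ω ⟨i, hi⟩ h0 hfin
  have hi' : ∀ j, ‖S.macroPos i ω‖ ≤ ‖S.macroPos j ω‖ := fun j => by
    by_cases hj : j = i
    · rw [hj]
    · exact (hi j hj).le
  refine ⟨i, fun j hj => ?_, kthDist_div_le_iff hR0.le hfin h0 hi',
    lt_sir_iff hα hβ (serving_eq hα hPB hi) (h0 i)⟩
  by_contra hji
  exact absurd ((hj i (Ne.symm hji)).trans (mul_le_of_le_one_left (norm_nonneg _) hR1))
    (not_le.2 (hi j hji))

/-- The coverage probability of a cell-center user as a quotient: the Palm integral of the coverage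
event, divided by the probability `R ^ 2` of the cell-center event. -/
theorem coverageProb_eq (hS : S.IsModel μ lamB lamF zeta q) (hlamB : 0 < lamB) (hlamF : 0 ≤ lamF)
    (hzeta0 : 0 ≤ zeta) (hzeta1 : zeta ≤ 1) (hq0 : 0 ≤ q) (hq1 : q ≤ 1) {α PB PF β R : ℝ}
    (hα : 2 < α) (hPB : 0 < PB) (hPF : 0 < PF) (hβ : 0 < β) (hR0 : 0 < R) (hR1 : R ≤ 1) :
    S.coverageProb μ α PB PF R β = (R ^ 2)⁻¹ * (lamB * Real.pi /
      (lamF * q * Real.pi * (2 / α) * (β * (PF / PB)) ^ (2 / α) *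
        (Real.pi * (1 / Real.sin (Real.pi * (2 / α)))) +
        lamB * Real.pi * ((R ^ 2)⁻¹ + zeta * H β (2 / α) R))) := by
  have hα0 : 0 < α := by linarith
  have hκ' : 0 < β * (PF / PB) := by positivity
  have hsin := sin_pi_mul_two_div_pos hα
  have hH : 0 ≤ H β (2 / α) R := H_nonneg hβ hR0
  let A : ℕ → Set Ω := fun i => {ω | IsCenter R (fun j => S.macroPos j ω) i}
  let G : ℕ → Set Ω := fun i => {ω | relInterference (ENNReal.ofReal β)
    (ENNReal.ofReal (β * (PF / PB))) α i (S.positions ω) (S.marks ω) <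
      ENNReal.ofReal (S.macroFading i ω)}
  have hA : ∀ i, MeasurableSet (A i) := fun i =>
    measurable_pi_lambda _ hS.macro_poisson.measurable (measurableSet_isCenter R i)
  have hG : ∀ i, MeasurableSet (G i) := fun i => measurableSet_lt
    ((measurable_relInterference _ _ α i).comp (hS.measurable_positions.prodMk hS.measurable_marks))
    (hS.macro_fading_measurable i).ennreal_ofReal
  have hserv := hS.ae_exists_serving hlamB (PF := PF) hα0 hPB hβ hR0 hR1
  have hdisj : Pairwise (Function.onFun (AEDisjoint μ) A) := by
    intro i j hij
    refine measure_eq_zero_iff_ae_notMem.2 ?_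
    filter_upwards [hserv] with ω ⟨k, hk, _⟩ hω
    exact hij ((hk i hω.1).trans (hk j hω.2).symm)
  have hcc : S.cellCenter R =ᵐ[μ] ⋃ i, A i := by
    filter_upwards [hserv] with ω ⟨k, hk, hk1, _⟩
    refine propext (hk1.trans ⟨fun h => mem_iUnion.2 ⟨k, h⟩, fun h => ?_⟩)
    obtain ⟨i, hi⟩ := mem_iUnion.1 h
    exact hk i hi ▸ hi
  have hcov : (S.covered α PB PF β ∩ ⋃ i, A i : Set Ω) =ᵐ[μ] ⋃ i, A i ∩ G i := by
    filter_upwards [hserv] with ω ⟨k, hk, _, hk2⟩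
    refine propext ⟨fun h => ?_, fun h => ?_⟩
    · obtain ⟨i, hi⟩ := mem_iUnion.1 h.2
      obtain rfl := hk i hi
      exact mem_iUnion.2 ⟨i, hi, hk2.1 h.1⟩
    · obtain ⟨i, hi, hi'⟩ := mem_iUnion.1 h
      obtain rfl := hk i hi
      exact ⟨hk2.2 hi', mem_iUnion.2 ⟨i, hi⟩⟩
  have hμA : μ (⋃ i, A i) = ENNReal.ofReal (R ^ 2) := by
    rw [measure_iUnion₀ hdisj fun i => (hA i).nullMeasurableSet]
    exact hS.macro_poisson.tsum_measure_isCenter hlamB hR0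
  have hμAG := measure_iUnion₀ (μ := μ) (f := fun i => A i ∩ G i)
    (fun i j hij => (hdisj hij).mono inter_subset_left inter_subset_left)
    fun i => ((hA i).inter (hG i)).nullMeasurableSet
  rw [tsum_congr fun i => hS.measure_isCenter_inter_lt hlamB.le hlamF hzeta1 hq0 hq1 hα hκ' R i,
    hS.macro_poisson.tsum_lintegral_exclusion_add_lossExponent hlamB hzeta0 hzeta1 hβ hα hR0
      (by positivity)] at hμAG
  rw [Network.coverageProb, Measure.real, ProbabilityTheory.cond, measure_congr hcc,
    Measure.restrict_congr_set hcc, Measure.smul_apply,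
    Measure.restrict_apply' (MeasurableSet.iUnion hA), measure_congr hcov, hμA, hμAG, smul_eq_mul,
    ENNReal.toReal_mul, ENNReal.toReal_inv, ENNReal.toReal_ofReal (by positivity),
    ENNReal.toReal_ofReal (by positivity)]

end Network.IsModel

end

end HetNet


end

theorem theorem1 {Ω : Type*} [MeasurableSpace Ω] (μ : Measure Ω) [IsProbabilityMeasure μ]
    (S : HetNet.Network Ω) (lamB lamF zeta PB PF α β R pm : ℝ) (N : ℕ)
    (hlamB : 0 < lamB) (hlamF : 0 < lamF) (hzeta0 : 0 ≤ zeta) (hzeta1 : zeta ≤ 1)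
    (hPB : 0 < PB) (hPF : 0 < PF) (hα : 2 < α) (hβ : 0 < β) (hR0 : 0 < R) (hR1 : R ≤ 1)
    (hpm0 : 0 < pm) (hpm1 : pm ≤ 1) (hN : 1 ≤ pm * N)
    (hS : S.IsModel μ lamB lamF zeta (1 / (pm * N))) :
    -- the integral in `H` converges
    IntegrableOn (fun u : ℝ => 1 / (1 + u ^ (1 / (2 / α))))
      (Ioi (R ^ (-2 : ℝ) * β ^ (-(2 / α)))) ∧
    -- the coverage probability, with `δ = 2 / α`
    S.coverageProb μ α PB PF R β =
      (1 + zeta * R ^ 2 * HetNet.H β (2 / α) R +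
        Real.pi * (2 / α) * R ^ 2 * ((lamF / (pm * N)) / lamB) *
          (β * (PF / PB)) ^ (2 / α) * (1 / Real.sin (Real.pi * (2 / α))))⁻¹ ∧
    -- the case `δ = 1 / 2`
    HetNet.H β (1 / 2) R =
      β ^ (1 / 2 : ℝ) * Real.arctan (R ^ 2 * β ^ (1 / 2 : ℝ)) := by
  have hpmN : 0 < pm * N := by linarith
  refine ⟨HetNet.integrableOn_one_div_one_add_rpow (by rw [one_div_div]; linarith)
    (by positivity), ?_, ?_⟩
  · rw [hS.coverageProb_eq hlamB hlamF.le hzeta0 hzeta1 (by positivity)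
      ((div_le_one hpmN).2 hN) hα hPB hPF hβ hR0 hR1, ← div_eq_inv_mul, ← inv_inj, inv_inv,
      inv_div]
    have hpi := Real.pi_pos.ne'
    generalize (β * (PF / PB)) ^ (2 / α) = b
    generalize 1 / Real.sin (Real.pi * (2 / α)) = s
    generalize HetNet.H β (2 / α) R = h
    have hpmN' := hpmN.ne'
    generalize pm * (N : ℝ) = n at hpmN'
    have hα0 : α ≠ 0 := by linarith
    field_simp
    ring
  · have h2 : (1 : ℝ) / (1 / 2) = 2 := by norm_num
    have hpos : 0 < R ^ 2 * β ^ (1 / 2 : ℝ) := by positivity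
    have hlow : R ^ (-2 : ℝ) * β ^ (-(1 / 2) : ℝ) = (R ^ 2 * β ^ (1 / 2 : ℝ))⁻¹ := by
      rw [Real.rpow_neg hR0.le, Real.rpow_neg hβ.le, Real.rpow_two, mul_inv]
    simp only [HetNet.H, h2, Real.rpow_two, hlow]
    simp_rw [one_div (1 + (_ : ℝ) ^ 2)]
    rw [integral_Ioi_inv_one_add_sq, Real.arctan_inv_of_pos hpos, sub_sub_cancel]
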